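/- Let $n\ge 2$ and let $M$ be a closed (compact, Hausdorff, without boundary) connected orientable $C^\infty$ manifold of dimension $n$, equipped with a $C^\infty$ volume form $\omega$. For $s\in\mathbb{Z}^+\cup\{\infty\}$ let $\mathfrak{X}^s_\mu(M)$ be the set of vector fields of class $C^s$ on $M$ that are divergence-free with respect to $\omega$, i.e. in every smooth chart, writing $\omega=\rho\,dy_1\wedge\dots\wedge dy_n$, one has $\operatorname{div}X=\rho^{-1}\sum_i\partial_i(\rho X^i)=0$. Fix a finite regular smooth atlas of $M$, that is, smooth charts $\Phi_j:W_j\to\mathbb{R}^n$, $j\le m$, and open sets $V_j$ covering $M$ with $\overline{V_j}\subset W_j$, and let $$\|X\|_{C^r}=\max_{j\le m,\ 0\le k\le r}\ \sup_{\Phi_j(V_j)}\|D^kX_j\|$$ be the associated Whitney $C^r$ norm, where $X_j$ is the expression of $X$ in the chart $\Phi_j$. Then, for every positive integer $r$, $\mathfrak{X}^\infty_\mu(M)$ is $C^r$-dense in $\mathfrak{X}^r_\mu(M)$: $\mathfrak{X}^\infty_\mu(M)\subset\mathfrak{X}^r_\mu(M)$, and for every $X\in\mathfrak{X}^r_\mu(M)$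 and every $\varepsilon>0$ there is $Z\in\mathfrak{X}^\infty_\mu(M)$ with $\|Z-X\|_{C^r}<\varepsilon$. -/

import Mathlib

open scoped Manifold ContDiff ENNReal

noncomputable section

namespace DivFreeDensity

/-- The expression of a vector field `X` in the chart `φ`: the map
`y ↦ Dφ (X (φ⁻¹ y))`, meaningful on `φ.target`. -/
def localRep {n : ℕ} {M : Type*} [TopologicalSpace M] [ChartedSpace (EuclideanSpace ℝ (Fin n)) M]
    (φ : OpenPartialHomeomorph M (EuclideanSpace ℝ (Fin n)))
    (X : (x : M) → TangentSpace (𝓡 n) x) (y : EuclideanSpace ℝ (Fin n)) :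
    EuclideanSpace ℝ (Fin n) :=
  mfderiv (𝓡 n) (𝓡 n) φ (φ.symm y) (X (φ.symm y))

/-- The coefficient of an `n`-form `vol` in the chart `φ`, that is, the function `ρ` on `φ.target`
with `(φ⁻¹)^* vol = ρ dy₁ ∧ ⋯ ∧ dyₙ`: the value of `vol` on the coordinate frame of `φ`. -/
def density {n : ℕ} {M : Type*} [TopologicalSpace M] [ChartedSpace (EuclideanSpace ℝ (Fin n)) M]
    (vol : (x : M) → TangentSpace (𝓡 n) x [⋀^Fin n]→L[ℝ] ℝ)
    (φ : OpenPartialHomeomorph M (EuclideanSpace ℝ (Fin n)))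
    (y : EuclideanSpace ℝ (Fin n)) : ℝ :=
  vol (φ.symm y) fun i ↦ mfderiv (𝓡 n) (𝓡 n) φ.symm y (EuclideanSpace.single i (1 : ℝ))

/-- A smooth volume form on an `n`-manifold: a nowhere vanishing `n`-form whose coefficient in
every smooth chart is `C^∞`. -/
structure VolumeForm (n : ℕ) (M : Type*) [TopologicalSpace M]
    [ChartedSpace (EuclideanSpace ℝ (Fin n)) M] where
  toFun : (x : M) → TangentSpace (𝓡 n) x [⋀^Fin n]→L[ℝ] ℝ
  ne_zero : ∀ x, toFun x ≠ 0
  smooth : ∀ φ ∈ IsManifold.maximalAtlas (𝓡 n) ∞ M, ContDiffOn ℝ ∞ (density toFun φ) φ.target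

/-- The divergence of `X` with respect to `vol` (defined by `L_X vol = (div X) vol`), written in the
chart `φ`: `ρ⁻¹ ∑ᵢ ∂ᵢ (ρ Xⁱ)`. -/
def chartDivergence {n : ℕ} {M : Type*} [TopologicalSpace M]
    [ChartedSpace (EuclideanSpace ℝ (Fin n)) M]
    (vol : VolumeForm n M) (X : (x : M) → TangentSpace (𝓡 n) x)
    (φ : OpenPartialHomeomorph M (EuclideanSpace ℝ (Fin n)))
    (y : EuclideanSpace ℝ (Fin n)) : ℝ :=
  (density vol.toFun φ y)⁻¹ *
    ∑ i : Fin n, fderiv ℝ (fun z ↦ density vol.toFun φ z * localRep φ X z i) y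
      (EuclideanSpace.single i (1 : ℝ))

/-- `X` is divergence-free with respect to `vol`: its divergence vanishes identically
in every smooth chart. -/
def IsDivFree {n : ℕ} {M : Type*} [TopologicalSpace M] [ChartedSpace (EuclideanSpace ℝ (Fin n)) M]
    (vol : VolumeForm n M) (X : (x : M) → TangentSpace (𝓡 n) x) : Prop :=
  ∀ φ ∈ IsManifold.maximalAtlas (𝓡 n) ∞ M, ∀ y ∈ φ.target, chartDivergence vol X φ y = 0

/-- The vector fields on `M` of class `C^s` that are divergence-free with respect to `vol`. -/
def divFreeFields {n : ℕ} {M : Type*} [TopologicalSpace M]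
    [ChartedSpace (EuclideanSpace ℝ (Fin n)) M] [IsManifold (𝓡 n) ∞ M]
    (vol : VolumeForm n M) (s : ℕ∞) : Set ((x : M) → TangentSpace (𝓡 n) x) :=
  {X | ContMDiff (𝓡 n) (𝓡 n).tangent s (fun x ↦ (⟨x, X x⟩ : TangentBundle (𝓡 n) M)) ∧
    IsDivFree vol X}

/-- A finite regular smooth atlas: finitely many smooth charts `Φ j`, with domains `W j`, and an
open cover of `M` by sets `V j` whose closures lie in `W j`. The charts of the atlas are the
restrictions of `Φ j` to `V j`. -/
structure RegularAtlas (n : ℕ) (M : Type*) [TopologicalSpace M]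
    [ChartedSpace (EuclideanSpace ℝ (Fin n)) M] where
  m : ℕ
  Φ : Fin m → OpenPartialHomeomorph M (EuclideanSpace ℝ (Fin n))
  V : Fin m → Set M
  chart_mem : ∀ j, Φ j ∈ IsManifold.maximalAtlas (𝓡 n) ∞ M
  isOpen_V : ∀ j, IsOpen (V j)
  closure_subset : ∀ j, closure (V j) ⊆ (Φ j).source
  cover : ⋃ j, V j = Set.univ

/-- The Whitney `C^r` norm with respect to a regular atlas, with values in `[0, ∞]`: the supremum
over the charts `j`, the orders `k ≤ r` and the points `y ∈ Φ j (V j)` of the operator norm of the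
`k`-th derivative of the local expression of `X` (with the Euclidean norm on `ℝⁿ`). -/
def whitneyNorm {n : ℕ} {M : Type*} [TopologicalSpace M]
    [ChartedSpace (EuclideanSpace ℝ (Fin n)) M]
    (A : RegularAtlas n M) (r : ℕ) (X : (x : M) → TangentSpace (𝓡 n) x) : ℝ≥0∞ :=
  ⨆ (j : Fin A.m) (k : ℕ) (_ : k ≤ r) (y ∈ A.Φ j '' A.V j),
    ‖iteratedFDeriv ℝ k (localRep (A.Φ j) X) y‖ₑ

/-- `S` is a `C^r`-dense subset of `T`, for the `C^r` norm given by the regular atlas `A`. -/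
def IsCrDenseIn {n : ℕ} {M : Type*} [TopologicalSpace M]
    [ChartedSpace (EuclideanSpace ℝ (Fin n)) M]
    (A : RegularAtlas n M) (r : ℕ) (S T : Set ((x : M) → TangentSpace (𝓡 n) x)) : Prop :=
  S ⊆ T ∧ ∀ X ∈ T, ∀ ε : ℝ, 0 < ε → ∃ Z ∈ S, whitneyNorm A r (Z - X) < ENNReal.ofReal ε

end DivFreeDensity

end

open scoped Manifold ContDiff ENNReal

noncomputable section

namespace DivFreeDensity

/-! In a chart with density `ρ`, a field `X` is divergence-free exactly when `Y = ρ X` has zero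
Euclidean divergence, that is, when `Y` read as an `(n-1)`-form is closed. Closedness survives
pull-back, hence also averaging over the pull-backs by `y ↦ y + t χ(y) v`, weighted by a bump `η(v)`
of integral one on the unit ball (`euclDiv_piola`, `euclDiv_smear`). Since `χ` has compact support
in the chart, the averaged field equals `X` off that support and lives on all of `M`: localizing
costs no divergence.

Where `t χ ≠ 0`, the average is a convolution of variable radius `t χ(y)`, hence smooth
(`contDiffAt_smear_of_ne_zero`). Near a compact set where `X` is already smooth, it stays smooth for
small `t`, even where `χ` vanishes (`contDiffOn_smear`). The family is jointly `C^r` in `(t, y)` and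
equals `X` at `t = 0`, so compactness gives convergence in the Whitney norm
(`eventually_whitneyNorm_smearedField_lt`). Smoothing chart by chart over the finite atlas, without
losing the smoothness gained before, yields the approximation (`exists_divFree_smooth_near_union`).
-/

open MeasureTheory Set Filter Topology Metric

/-! ### Integrals depending on a parameter. -/

section ParametricIntegral

theorem integrable_section {P G F : Type*} [TopologicalSpace P] [NormedAddCommGroup G]
    [MeasurableSpace G] [BorelSpace G] [NormedAddCommGroup F] {μ : Measure G}
    [IsLocallyFiniteMeasure μ] {h : P → G → F} {s : Set P} {k : Set G} (hk : IsCompact k) {q : P}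
    (hc : ContinuousOn ↿h (s ×ˢ univ)) (hq : q ∈ s) (h0 : ∀ u ∉ k, h q u = 0) :
    Integrable (h q) μ :=
  (hc.comp_continuous (f := fun u : G ↦ (q, u)) (by fun_prop)
    (fun _ ↦ ⟨hq, mem_univ _⟩)).integrable_of_hasCompactSupport (HasCompactSupport.intro hk h0)

variable {P G E₁ E₂ E₃ : Type*} [NormedAddCommGroup P] [NormedSpace ℝ P]
  [NormedAddCommGroup G] [NormedSpace ℝ G] [MeasurableSpace G] [BorelSpace G]
  [NormedAddCommGroup E₁] [NormedSpace ℝ E₁] [NormedAddCommGroup E₂] [NormedSpace ℝ E₂]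
  [NormedAddCommGroup E₃] [NormedSpace ℝ E₃] {μ : Measure G}

/-- An integral against a kernel of class `C^n` in the parameter and the variable, with compact
support in the variable, is of class `C^n` in the parameter. -/
theorem contDiffOn_integral_bilin {f : G → E₁} {n : ℕ∞} (L : E₁ →L[ℝ] E₂ →L[ℝ] E₃)
    {g : P → G → E₂} {s : Set P} {k : Set G} (hs : IsOpen s) (hk : IsCompact k)
    (hgs : ∀ p, ∀ x, p ∈ s → x ∉ k → g p x = 0) (hf : LocallyIntegrable f μ)
    (hg : ContDiffOn ℝ n ↿g (s ×ˢ univ)) :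
    ContDiffOn ℝ n (fun p ↦ ∫ u, L (f u) (g p u) ∂μ) s := by
  -- The integral is the value at `0` of the convolution of `f` with the reflected kernel `x ↦ g p
  -- (-x)`.
  have hg' : ContDiffOn ℝ n ↿(fun (p : P) (x : G) ↦ g p (-x)) (s ×ˢ univ) :=
    hg.comp (f := fun q : P × G ↦ (q.1, -q.2)) (by fun_prop) (fun q hq ↦ ⟨hq.1, mem_univ _⟩)
  have h := contDiffOn_convolution_right_with_param (μ := μ) L hs hk.neg
    (g := fun p x ↦ g p (-x)) (fun p x hp hx ↦ hgs p _ hp (by simpa using hx)) hf hg'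
  have h2 := h.comp (f := fun p : P ↦ (p, (0 : G))) (by fun_prop)
    (fun p hp ↦ ⟨hp, mem_univ _⟩) (s := s)
  simpa [Function.comp_def, convolution] using h2

variable [IsLocallyFiniteMeasure μ]

theorem contDiffOn_integral {n : ℕ∞} {g : P → G → E₂} {s : Set P} {k : Set G} (hs : IsOpen s)
    (hk : IsCompact k) (hgs : ∀ p, ∀ x, p ∈ s → x ∉ k → g p x = 0)
    (hg : ContDiffOn ℝ n ↿g (s ×ˢ univ)) :
    ContDiffOn ℝ n (fun p ↦ ∫ u, g p u ∂μ) s := by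
  simpa using contDiffOn_integral_bilin (μ := μ) (f := fun _ ↦ (1 : ℝ))
    (ContinuousLinearMap.lsmul ℝ ℝ) hs hk hgs (locallyIntegrable_const _) hg

theorem hasFDerivAt_integral_of_contDiffOn {g : P → G → E₂} {s : Set P} {k : Set G}
    (hs : IsOpen s) (hk : IsCompact k) (hgs : ∀ p, ∀ x, p ∈ s → x ∉ k → g p x = 0)
    (hg : ContDiffOn ℝ 1 ↿g (s ×ˢ univ)) {p : P} (hp : p ∈ s) :
    HasFDerivAt (fun p ↦ ∫ u, g p u ∂μ) (∫ u, fderiv ℝ (fun p ↦ g p u) p ∂μ) p := by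
  have hgc : ContinuousOn (fun q : P × G ↦ fderiv ℝ ↿g q) (s ×ˢ univ) :=
    hg.continuousOn_fderiv_of_isOpen (hs.prod isOpen_univ) le_rfl
  have hgd : ∀ q : P × G, q.1 ∈ s → HasFDerivAt ↿g (fderiv ℝ ↿g q) q := fun q hq ↦
    ((hg.differentiableOn one_ne_zero).differentiableAt
      ((hs.prod isOpen_univ).mem_nhds ⟨hq, mem_univ _⟩)).hasFDerivAt
  set g' : P → G → P →L[ℝ] E₂ := fun p u ↦
    (fderiv ℝ ↿g (p, u)).comp (ContinuousLinearMap.inl ℝ P G) with hg'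
  have hd : ∀ p ∈ s, ∀ u, HasFDerivAt (fun p ↦ g p u) (g' p u) p := fun p hp u ↦
    HasFDerivAt.comp (g := ↿g) (f := fun q : P ↦ (q, u)) p (hgd (p, u) hp)
      (hasFDerivAt_prodMk_left p u)
  have hg'c : ContinuousOn ↿g' (s ×ˢ univ) := by
    change ContinuousOn (fun q : P × G ↦ (fderiv ℝ ↿g q).comp (ContinuousLinearMap.inl ℝ P G)) _
    exact hgc.clm_comp continuousOn_const
  have hz : ∀ p ∈ s, ∀ u ∉ k, g' p u = 0 := fun p hp u hu ↦ by
    refine (hd p hp u).unique ((hasFDerivAt_const (0 : E₂) p).congr_of_eventuallyEq ?_)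
    filter_upwards [hs.mem_nhds hp] with q hq using hgs q u hq hu
  -- Domination: `g'` is bounded on the compact slice `{p} × k`, and by continuity and the tube
  -- lemma the bound plus one holds for all nearby parameters.
  obtain ⟨C, t, ht, hC⟩ : ∃ C : ℝ, ∃ t ∈ 𝓝 p, ∀ q ∈ t ∩ s, ∀ u ∈ k, ‖g' q u‖ ≤ C := by
    have hcs : ContinuousOn (g' p) k := (hg'c.comp_continuous (f := fun u : G ↦ (p, u))
      (by fun_prop) (fun u ↦ ⟨hp, mem_univ _⟩)).continuousOn
    obtain ⟨C, hC⟩ := hk.exists_bound_of_continuousOn hcs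
    refine ⟨C + 1, ?_⟩
    have : ∀ᶠ q in 𝓝 p, ∀ u ∈ k, q ∈ s → ‖g' q u‖ ≤ C + 1 := by
      apply hk.eventually_forall_of_forall_eventually
      intro u hu
      have hca : ContinuousAt ↿g' (p, u) :=
        hg'c.continuousAt ((hs.prod isOpen_univ).mem_nhds ⟨hp, mem_univ _⟩)
      have : ∀ᶠ z in 𝓝 (p, u), ‖(↿g') z‖ < C + 1 :=
        hca.norm.eventually_lt continuousAt_const (by
          have := hC u hu; change ‖g' p u‖ < _; linarith)
      filter_upwards [this] with z hz _ using hz.le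
    exact ⟨_, this, fun q hq u hu ↦ hq.1 u hu hq.2⟩
  have hmain := hasFDerivAt_integral_of_dominated_of_fderiv_le (μ := μ) (F := g) (F' := g')
    (bound := k.indicator fun _ ↦ C) (x₀ := p) (s := t ∩ s)
    (inter_mem ht (hs.mem_nhds hp)) ?_ ?_ ?_ ?_ ?_ ?_
  · convert hmain using 3
    exact (hd p hp _).fderiv
  · filter_upwards [hs.mem_nhds hp] with q hq
    exact (integrable_section hk hg.continuousOn hq (fun u hu ↦ hgs q u hq hu)).aestronglyMeasurable
  · exact integrable_section hk hg.continuousOn hp (fun u hu ↦ hgs p u hp hu)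
  · exact (integrable_section hk hg'c hp (hz p hp)).aestronglyMeasurable
  · refine Eventually.of_forall fun u q hq ↦ ?_
    by_cases hu : u ∈ k
    · simpa [hu] using hC q hq u hu
    · simp [hu, hz q hq.2 u hu]
  · exact (integrable_indicator_iff hk.measurableSet).2
      (integrableOn_const hk.measure_lt_top.ne)
  · exact Eventually.of_forall fun u q hq ↦ hd q hq.2 u

end ParametricIntegral

/-! ### Divergence as the trace of the derivative. -/

section Trace

variable {E : Type*} [NormedAddCommGroup E] [NormedSpace ℝ E] [FiniteDimensional ℝ E]

/-- The divergence of a vector field on a finite-dimensional space. -/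
def euclDiv (Y : E → E) (y : E) : ℝ := LinearMap.trace ℝ E (fderiv ℝ Y y)

variable (E) in
/-- The trace as a continuous linear functional. -/
def traceCLM : (E →L[ℝ] E) →L[ℝ] ℝ :=
  LinearMap.toContinuousLinearMap
    ((LinearMap.trace ℝ E).comp (ContinuousLinearMap.coeLM ℝ))

@[simp] theorem traceCLM_apply (A : E →L[ℝ] E) : traceCLM E A = LinearMap.trace ℝ E A := rfl

theorem euclDiv_eq (Y : E → E) (y : E) : euclDiv Y y = traceCLM E (fderiv ℝ Y y) := rfl

theorem traceCLM_smulRight (l : E →L[ℝ] ℝ) (w : E) : traceCLM E (l.smulRight w) = l w := by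
  simp

theorem traceCLM_comp_comm (A B : E →L[ℝ] E) :
    traceCLM E (A.comp B) = traceCLM E (B.comp A) := by
  exact LinearMap.trace_mul_comm ℝ (A : E →ₗ[ℝ] E) (B : E →ₗ[ℝ] E)

end Trace

/-! ### Averaging pull-backs of closed `(n-1)`-forms on a vector space. -/

section Piola

variable {E : Type*} [NormedAddCommGroup E] [NormedSpace ℝ E]

/-- The pull-back of `Y`, regarded as a form of degree `n - 1`, by `y ↦ y + χ y • v`. -/
def piola (χ : E → ℝ) (Y : E → E) (v y : E) : E :=
  (1 + fderiv ℝ χ y v) • Y (y + χ y • v) - fderiv ℝ χ y (Y (y + χ y • v)) • v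

variable {χ η : E → ℝ} {Y : E → E}

theorem contDiffAt_piola {n : ℕ∞} (hχ : ContDiff ℝ ∞ χ) {t : ℝ} {y v : E}
    (hY : ContDiffAt ℝ n Y (y + χ y • t • v)) :
    ContDiffAt ℝ n (fun q : (ℝ × E) × E ↦ piola χ Y (q.1.1 • q.2) q.1.2) ((t, y), v) := by
  have hχn : ContDiff ℝ n χ := hχ.of_le (by exact_mod_cast le_top)
  have hdχ : ContDiff ℝ n (fderiv ℝ χ) :=
    (hχ.fderiv_right (m := ∞) (by simp)).of_le (by exact_mod_cast le_top)
  have h1 : ContDiffAt ℝ n (fun q : (ℝ × E) × E ↦ χ q.1.2) ((t, y), v) := by fun_prop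
  have h2 : ContDiffAt ℝ n (fun q : (ℝ × E) × E ↦ fderiv ℝ χ q.1.2) ((t, y), v) := by fun_prop
  have h3 : ContDiffAt ℝ n (fun q : (ℝ × E) × E ↦ q.1.1 • q.2) ((t, y), v) := by fun_prop
  have h4 : ContDiffAt ℝ n
      (fun q : (ℝ × E) × E ↦ q.1.2 + χ q.1.2 • q.1.1 • q.2) ((t, y), v) := by fun_prop
  have h5 : ContDiffAt ℝ n
      (fun q : (ℝ × E) × E ↦ Y (q.1.2 + χ q.1.2 • q.1.1 • q.2)) ((t, y), v) :=
    ContDiffAt.comp (g := Y) ((t, y), v) hY h4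
  exact ((contDiffAt_const.add (h2.clm_apply h3)).smul h5).sub ((h2.clm_apply h5).smul h3)

/-- This is the Piola identity. The map `ψ = id + χ v` has derivative a rank-one perturbation of the
identity, with determinant `1 + dχ(v)` and adjugate `(1 + dχ(v)) I - v ⊗ dχ`; thus `piola χ Y v` is
`adj(Dψ) (Y ∘ ψ)`. Being polynomial in `Dψ`, the formula does not require `ψ` to be invertible. -/
theorem euclDiv_piola [FiniteDimensional ℝ E] (hχ : ContDiff ℝ ∞ χ) {y v : E}
    (hY : DifferentiableAt ℝ Y (y + χ y • v)) :
    euclDiv (piola χ Y v) y = (1 + fderiv ℝ χ y v) * euclDiv Y (y + χ y • v) := by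
  have hχ1 : HasFDerivAt χ (fderiv ℝ χ y) y :=
    (hχ.contDiffAt.differentiableAt (by simp)).hasFDerivAt
  have hχ2 : HasFDerivAt (fderiv ℝ χ) (fderiv ℝ (fderiv ℝ χ) y) y :=
    ((hχ.fderiv_right (m := ∞) (by simp)).contDiffAt.differentiableAt (by simp)).hasFDerivAt
  have hsymm : ∀ a b, fderiv ℝ (fderiv ℝ χ) y a b = fderiv ℝ (fderiv ℝ χ) y b a := fun a b ↦
    (hχ.contDiffAt.isSymmSndFDerivAt
      (by rw [minSmoothness_of_isRCLikeNormedField]; exact WithTop.coe_le_coe.2 le_top)) a b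
  have hψ : HasFDerivAt (fun z ↦ z + χ z • v)
      (ContinuousLinearMap.id ℝ E + (fderiv ℝ χ y).smulRight v) y :=
    (hasFDerivAt_id y).add (hχ1.smul_const v)
  have hYψ := HasFDerivAt.comp (g := Y) y hY.hasFDerivAt hψ
  have hv : HasFDerivAt (fun z ↦ 1 + fderiv ℝ χ z v)
      ((fderiv ℝ (fderiv ℝ χ) y).flip v) y := by
    have := (hχ2.clm_apply (hasFDerivAt_const v y)).const_add 1
    simpa using this
  have hmain := (hv.smul hYψ).sub ((hχ2.clm_apply hYψ).smul_const v)
  rw [euclDiv_eq, euclDiv_eq]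
  have hfd : fderiv ℝ (piola χ Y v) y = _ := hmain.fderiv
  rw [hfd]
  simp only [Function.comp_apply, map_sub, map_add, map_smul, traceCLM_smulRight,
    ContinuousLinearMap.comp_add, ContinuousLinearMap.comp_id]
  have hcomp : (fderiv ℝ Y (y + χ y • v)).comp ((fderiv ℝ χ y).smulRight v) =
      (fderiv ℝ χ y).smulRight (fderiv ℝ Y (y + χ y • v) v) := by
    ext w; simp
  rw [hcomp, traceCLM_smulRight]
  simp only [add_apply, ContinuousLinearMap.comp_apply,
    ContinuousLinearMap.flip_apply, ContinuousLinearMap.smulRight_apply, map_smul,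
    smul_eq_mul]
  -- Symmetry of the Hessian of `χ` makes the two second-order terms cancel.
  rw [hsymm v]
  ring

/-- The average of the pull-backs `piola χ Y (t • v)` with weight `η v`. -/
def smear [MeasurableSpace E] (μ : Measure E) (η χ : E → ℝ) (Y : E → E) (t : ℝ) (y : E) : E :=
  ∫ v, η v • piola χ Y (t • v) y ∂μ

/-- The kernel of the averaging operator after the substitution `u = y + χ y • t • v`. -/
def smearKernel (η χ : E → ℝ) (t : ℝ) (y u : E) : E →L[ℝ] E :=
  (|((χ y * t) ^ Module.finrank ℝ E)⁻¹| * η ((χ y * t)⁻¹ • (u - y))) •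
    ((1 + fderiv ℝ χ y (t • (χ y * t)⁻¹ • (u - y))) • ContinuousLinearMap.id ℝ E -
      (fderiv ℝ χ y).smulRight (t • (χ y * t)⁻¹ • (u - y)))

/-- The pairs `(t, y)` such that `smear μ η χ Y t y` only depends on `Y` on `O`. -/
def smearDomain (χ : E → ℝ) (O : Set E) : Set (ℝ × E) :=
  {p | ∀ v ∈ closedBall (0 : E) 1, p.2 + χ p.2 • p.1 • v ∈ O}

theorem contDiffOn_smear_integrand {n : ℕ∞} (hχ : ContDiff ℝ ∞ χ) (hη : ContDiff ℝ ∞ η)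
    (hη0 : ∀ v ∉ closedBall (0 : E) 1, η v = 0) {O : Set E} (hO : IsOpen O)
    (hY : ContDiffOn ℝ n Y O) :
    ContDiffOn ℝ n ↿(fun (p : ℝ × E) v ↦ η v • piola χ Y (p.1 • v) p.2)
      (smearDomain χ O ×ˢ univ) := by
  rintro ⟨⟨t, y⟩, v⟩ ⟨hp, -⟩
  apply ContDiffAt.contDiffWithinAt
  by_cases hv : v ∈ closedBall (0 : E) 1
  · have h1 : ContDiffAt ℝ n (fun q : (ℝ × E) × E ↦ η q.2) ((t, y), v) :=
      (hη.of_le (by exact_mod_cast le_top)).contDiffAt.comp _ contDiffAt_snd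
    exact h1.smul (contDiffAt_piola hχ (hY.contDiffAt (hO.mem_nhds (hp v hv))))
  -- Off the unit ball `Y` may be evaluated outside `O`, where nothing is known; but there `η`,
  -- hence the integrand, vanishes on a neighbourhood.
  · refine (contDiffAt_const (c := (0 : E))).congr_of_eventuallyEq ?_
    have : ∀ᶠ q : (ℝ × E) × E in 𝓝 ((t, y), v), q.2 ∉ closedBall (0 : E) 1 :=
      (isClosed_closedBall.isOpen_compl.preimage continuous_snd).mem_nhds hv
    filter_upwards [this] with q hq
    change η q.2 • _ = (0 : E)
    rw [hη0 _ hq, zero_smul]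

variable [FiniteDimensional ℝ E]

theorem isOpen_smearDomain (hχ : Continuous χ) {O : Set E} (hO : IsOpen O) :
    IsOpen (smearDomain χ O) := by
  rw [isOpen_iff_mem_nhds]
  intro p hp
  apply (isCompact_closedBall (0 : E) 1).eventually_forall_of_forall_eventually
  intro v hv
  have hc : Continuous (fun z : (ℝ × E) × E ↦ z.1.2 + χ z.1.2 • z.1.1 • z.2) := by fun_prop
  exact hc.continuousAt.eventually (hO.mem_nhds (hp v hv))

theorem eventually_mem_smearDomain (hχ : Continuous χ) {O K : Set E} (hO : IsOpen O)
    (hK : IsCompact K) (hKO : K ⊆ O) : ∀ᶠ t : ℝ in 𝓝 0, ∀ y ∈ K, (t, y) ∈ smearDomain χ O := by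
  apply hK.eventually_forall_of_forall_eventually
  intro y hy
  exact (isOpen_smearDomain hχ hO).mem_nhds (fun v _ ↦ by simpa using hKO hy)

/-- Off the support of `χ` points are not displaced, so smallness of `t` matters only on the compact
set `tsupport χ`. -/
theorem eventually_forall_mem_smearDomain (hχ : Continuous χ) {O : Set E} (hO : IsOpen O)
    (hc : HasCompactSupport χ) (hKO : tsupport χ ⊆ O) :
    ∀ᶠ t : ℝ in 𝓝 0, ∀ y ∈ O, (t, y) ∈ smearDomain χ O := by
  filter_upwards [eventually_mem_smearDomain hχ hO hc hKO] with t ht y hy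
  by_cases h : y ∈ tsupport χ
  · exact ht y h
  · intro v _
    simpa [image_eq_zero_of_notMem_tsupport h] using hy

variable [MeasurableSpace E] {μ : Measure E}

theorem smear_of_notMem_tsupport (hη1 : ∫ v, η v ∂μ = 1) {t : ℝ} {y : E} (hy : y ∉ tsupport χ) :
    smear μ η χ Y t y = Y y := by
  have h1 : χ y = 0 := image_eq_zero_of_notMem_tsupport hy
  have h2 : fderiv ℝ χ y = 0 := by
    have : χ =ᶠ[𝓝 y] fun _ ↦ 0 := notMem_tsupport_iff_eventuallyEq.1 hy
    rw [this.fderiv_eq]; simp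
  simp [smear, piola, h1, h2, integral_smul_const, hη1]

theorem smear_zero (hη1 : ∫ v, η v ∂μ = 1) (y : E) : smear μ η χ Y 0 y = Y y := by
  simp [smear, piola, integral_smul_const, hη1]

variable [BorelSpace E] [μ.IsAddHaarMeasure]

/-- Differentiation falls on `Y` here, so no regularity is gained, but `t = 0` and the zeros of `χ`
are allowed. It serves twice: with finite order for closeness as `t → 0`, and with infinite order
for keeping smoothness already obtained. -/
theorem contDiffOn_smear {n : ℕ∞} (hχ : ContDiff ℝ ∞ χ) (hη : ContDiff ℝ ∞ η)
    (hη0 : ∀ v ∉ closedBall (0 : E) 1, η v = 0) {O : Set E} (hO : IsOpen O)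
    (hY : ContDiffOn ℝ n Y O) :
    ContDiffOn ℝ n (fun p : ℝ × E ↦ smear μ η χ Y p.1 p.2) (smearDomain χ O) :=
  contDiffOn_integral (isOpen_smearDomain hχ.continuous hO) (isCompact_closedBall (0 : E) 1)
    (fun p v _ hv ↦ by rw [hη0 v hv, zero_smul]) (contDiffOn_smear_integrand hχ hη hη0 hO hY)

theorem euclDiv_smear (hχ : ContDiff ℝ ∞ χ) (hη : ContDiff ℝ ∞ η)
    (hη0 : ∀ v ∉ closedBall (0 : E) 1, η v = 0) {O : Set E} (hO : IsOpen O)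
    (hY : ContDiffOn ℝ 1 Y O) (hdiv : ∀ y ∈ O, euclDiv Y y = 0) {t : ℝ} {y : E}
    (hty : (t, y) ∈ smearDomain χ O) : euclDiv (smear μ η χ Y t) y = 0 := by
  set s : Set E := (fun y ↦ (t, y)) ⁻¹' smearDomain χ O with hs
  have hso : IsOpen s := (isOpen_smearDomain hχ.continuous hO).preimage (by fun_prop)
  have hg : ContDiffOn ℝ 1 ↿(fun (y : E) v ↦ η v • piola χ Y (t • v) y) (s ×ˢ univ) :=
    (contDiffOn_smear_integrand (n := 1) hχ hη hη0 hO hY).comp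
      (f := fun q : E × E ↦ ((t, q.1), q.2)) (by fun_prop) (fun q hq ↦ ⟨hq.1, mem_univ _⟩)
  have hder := hasFDerivAt_integral_of_contDiffOn (μ := μ) hso (isCompact_closedBall (0 : E) 1)
    (fun p v _ hv ↦ by rw [hη0 v hv, zero_smul]) hg hty
  have hfd : fderiv ℝ (smear μ η χ Y t) y = _ := hder.fderiv
  rw [euclDiv_eq, hfd]
  -- The trace commutes with an integral that converges; otherwise the integral is `0` by convention
  -- and so is its trace, so integrability need not be proved.
  by_cases hint : Integrable (fun v ↦ fderiv ℝ (fun y ↦ η v • piola χ Y (t • v) y) y) μ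
  · rw [← ContinuousLinearMap.integral_comp_comm _ hint]
    refine integral_eq_zero_of_ae (Eventually.of_forall fun v ↦ ?_)
    by_cases hv : v ∈ closedBall (0 : E) 1
    · have hYd := hY.contDiffAt (hO.mem_nhds (hty v hv))
      have hd : DifferentiableAt ℝ (piola χ Y (t • v)) y := by
        have := (contDiffAt_piola (n := 1) hχ hYd).comp (f := fun z : E ↦ ((t, z), v)) y
          (by fun_prop)
        exact this.differentiableAt (by simp)
      simp only [Pi.zero_apply]
      rw [fderiv_fun_const_smul hd, map_smul, ← euclDiv_eq,
        euclDiv_piola hχ (hYd.differentiableAt (by simp)), hdiv _ (hty v hv)]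
      simp
    · simp [hη0 v hv]
  · rw [integral_undef hint, map_zero]

/-- The substitution `u = y + χ(y) t v` moves the dependence on `y` from `Y` to a kernel built from
`χ` and `η`. -/
theorem smear_eq_integral_kernel {t : ℝ} {y : E} (h : χ y * t ≠ 0) :
    smear μ η χ Y t y = ∫ u, smearKernel η χ t y u (Y u) ∂μ := by
  set c := χ y * t with hc
  let Ψ : E → E := fun u ↦ η (c⁻¹ • (u - y)) •
    ((1 + fderiv ℝ χ y (t • c⁻¹ • (u - y))) • Y u - fderiv ℝ χ y (Y u) • (t • c⁻¹ • (u - y)))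
  have h1 : smear μ η χ Y t y = ∫ v, Ψ (y + c • v) ∂μ := by
    refine integral_congr_ae (Eventually.of_forall fun v ↦ ?_)
    have hv : c⁻¹ • (y + c • v - y) = v := by
      rw [add_sub_cancel_left, smul_smul, inv_mul_cancel₀ h, one_smul]
    simp only [Ψ, hv, piola]
    rw [smul_smul (χ y) t v]
  have h2 : ∫ v, Ψ (y + c • v) ∂μ = |(c ^ Module.finrank ℝ E)⁻¹| • ∫ u, Ψ (y + u) ∂μ :=
    Measure.integral_comp_smul μ (fun u ↦ Ψ (y + u)) c
  rw [h1, h2, integral_add_left_eq_self, ← integral_smul]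
  refine integral_congr_ae (Eventually.of_forall fun u ↦ ?_)
  simp [Ψ, smearKernel, ← hc, smul_smul]

/-- The regularizing step: the convolution radius `χ(y) t` stays away from `0` near `y`, so the
kernel is smooth in `y` and `Y` need only be continuous. -/
theorem contDiffAt_smear_of_ne_zero (hχ : ContDiff ℝ ∞ χ) (hη : ContDiff ℝ ∞ η)
    (hη0 : ∀ v ∉ closedBall (0 : E) 1, η v = 0) {O : Set E} (hO : IsOpen O)
    (hY : ContinuousOn Y O) {t : ℝ} {y : E} (hty : (t, y) ∈ smearDomain χ O) (ht : t ≠ 0)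
    (hy : χ y ≠ 0) : ContDiffAt ℝ ∞ (smear μ η χ Y t) y := by
  have hnhds : ∀ᶠ z in 𝓝 y, (t, z) ∈ smearDomain χ O ∧ χ z ≠ 0 := by
    refine Eventually.and ?_ (hχ.continuous.continuousAt.eventually_ne hy)
    exact ((isOpen_smearDomain hχ.continuous hO).preimage
      (f := fun z : E ↦ (t, z)) (by fun_prop)).mem_nhds hty
  obtain ⟨δ, hδ, hball⟩ := Metric.nhds_basis_closedBall.mem_iff.1 hnhds
  -- `C` collects all points where `Y` is sampled when the base point stays within `δ` of `y`: a
  -- compact subset of `O` off which the kernel vanishes.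
  set C : Set E := (fun q : E × E ↦ q.1 + χ q.1 • t • q.2) ''
    (closedBall y δ ×ˢ closedBall (0 : E) 1) with hC
  have hχc := hχ.continuous
  have hCc : IsCompact C :=
    ((isCompact_closedBall y δ).prod (isCompact_closedBall 0 1)).image (by fun_prop)
  have hCO : C ⊆ O := by
    rintro _ ⟨q, ⟨h1, h2⟩, rfl⟩
    exact (hball h1).1 _ h2
  have hzero : ∀ p u, p ∈ ball y δ → u ∉ C → smearKernel η χ t p u = 0 := by
    intro p u hp hu
    have hpc := ball_subset_closedBall hp
    have hne : χ p * t ≠ 0 := mul_ne_zero (hball hpc).2 ht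
    have : (χ p * t)⁻¹ • (u - p) ∉ closedBall (0 : E) 1 := by
      intro hmem
      refine hu ⟨(p, (χ p * t)⁻¹ • (u - p)), ⟨hpc, hmem⟩, ?_⟩
      change p + χ p • t • (χ p * t)⁻¹ • (u - p) = u
      rw [smul_smul, smul_smul, mul_inv_cancel₀ hne, one_smul, add_sub_cancel]
    rw [smearKernel, hη0 _ this, mul_zero, zero_smul]
  -- `Y` is controlled only on `O`; truncating it to `C` leaves the integral unchanged and gives a
  -- globally integrable function.
  have hf : LocallyIntegrable (C.indicator Y) μ :=
    ((integrable_indicator_iff hCc.measurableSet).2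
      ((hY.mono hCO).integrableOn_compact hCc)).locallyIntegrable
  have hker : ContDiffOn ℝ ∞ ↿(smearKernel η χ t) (ball y δ ×ˢ univ) := by
    rintro ⟨p, u⟩ ⟨hp, -⟩
    apply ContDiffAt.contDiffWithinAt
    have hne : χ p * t ≠ 0 := mul_ne_zero (hball (ball_subset_closedBall hp)).2 ht
    have hdχ : ContDiff ℝ ∞ (fderiv ℝ χ) := hχ.fderiv_right (by simp)
    have h1 : ContDiffAt ℝ ∞ (fun q : E × E ↦ χ q.1 * t) (p, u) := by fun_prop
    have h2 : ContDiffAt ℝ ∞ (fun q : E × E ↦ fderiv ℝ χ q.1) (p, u) := by fun_prop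
    have h3 : ContDiffAt ℝ ∞ (fun q : E × E ↦ (χ q.1 * t)⁻¹ • (q.2 - q.1)) (p, u) :=
      (h1.inv hne).smul (by fun_prop)
    have h4 : ContDiffAt ℝ ∞ (fun q : E × E ↦ |((χ q.1 * t) ^ Module.finrank ℝ E)⁻¹|) (p, u) :=
      ContDiffAt.comp (g := fun x : ℝ ↦ |x|) (p, u)
        (contDiffAt_abs (inv_ne_zero (pow_ne_zero _ hne))) ((h1.pow _).inv (pow_ne_zero _ hne))
    have h5 : ContDiffAt ℝ ∞ (fun q : E × E ↦ t • (χ q.1 * t)⁻¹ • (q.2 - q.1)) (p, u) :=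
      contDiffAt_const.smul h3
    have h6 : ContDiffAt ℝ ∞ (fun q : E × E ↦ η ((χ q.1 * t)⁻¹ • (q.2 - q.1))) (p, u) :=
      ContDiffAt.comp (g := η) (p, u) hη.contDiffAt h3
    exact (h4.mul h6).smul (((contDiffAt_const.add (h2.clm_apply h5)).smul contDiffAt_const).sub
      (h2.smulRight h5))
  have hmain := contDiffOn_integral_bilin (μ := μ) (n := ⊤) (ContinuousLinearMap.apply ℝ E)
    isOpen_ball hCc hzero hf hker
  refine (hmain.contDiffAt (ball_mem_nhds y hδ)).congr_of_eventuallyEq ?_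
  filter_upwards [ball_mem_nhds y hδ] with p hp
  rw [smear_eq_integral_kernel (mul_ne_zero (hball (ball_subset_closedBall hp)).2 ht)]
  refine integral_congr_ae (Eventually.of_forall fun u ↦ ?_)
  by_cases hu : u ∈ C
  · simp [hu]
  · simp [hu, hzero p u hp hu]

end Piola

/-! ### Derivative of the determinant and change of variables for the divergence. -/

section Jacobian

variable {E : Type*} [NormedAddCommGroup E] [NormedSpace ℝ E]

/-- Cramer's rule: both sides are linear in `x` and agree on the basis, since a repeated vector
kills the determinant. -/
theorem basis_det_update {ι : Type*} [Fintype ι] [DecidableEq ι] (b : Module.Basis ι ℝ E) (i : ι)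
    (x : E) : b.det (Function.update b i x) = b.repr x i := by
  have : (b.det.toMultilinearMap.toLinearMap b i) = b.coord i := by
    refine b.ext fun j ↦ ?_
    by_cases h : j = i
    · subst h; simp [Module.Basis.det_self]
    · have : b.det (Function.update b i (b j)) = 0 :=
        b.det.map_update_self b (Ne.symm h)
      simpa [Finsupp.single_apply, h] using this
  simpa using congrArg (fun f ↦ f x) this

variable [FiniteDimensional ℝ E]

/-- The determinant is multilinear in the images of a basis; its derivative at the identity replaces
one basis vector at a time, and each replacement contributes a diagonal entry. -/
theorem hasFDerivAt_det_one :
    HasFDerivAt (fun A : E →L[ℝ] E ↦ A.det) (traceCLM E) (1 : E →L[ℝ] E) := by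
  let b := Module.finBasis ℝ E
  have hc : Continuous b.det := by
    have : (b.det : (Fin _ → E) → ℝ) = fun v ↦ (b.toMatrix v).det := by
      ext v; exact b.det_apply v
    rw [this]
    refine Continuous.matrix_det (continuous_matrix fun i j ↦ ?_)
    exact (LinearMap.continuous_of_finiteDimensional (b.coord i)).comp (continuous_apply j)
  let f : ContinuousMultilinearMap ℝ (fun _ : Fin (Module.finrank ℝ E) ↦ E) ℝ :=
    ⟨b.det.toMultilinearMap, hc⟩
  let l : (E →L[ℝ] E) →L[ℝ] (Fin (Module.finrank ℝ E) → E) :=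
    ContinuousLinearMap.pi fun i ↦ ContinuousLinearMap.apply ℝ E (b i)
  have hdet : (fun A : E →L[ℝ] E ↦ A.det) = fun A ↦ f (l A) := by
    ext A
    have h := b.det_comp (A : E →ₗ[ℝ] E) b
    rw [b.det_self, mul_one] at h
    exact h.symm
  have h := HasFDerivAt.comp (g := f) (f := l) 1 (f.hasFDerivAt (l 1)) l.hasFDerivAt
  have hl : l 1 = b := by ext i; simp [l]
  rw [hdet]
  refine h.congr_fderiv (ContinuousLinearMap.ext fun B ↦ Eq.symm ?_)
  rw [ContinuousLinearMap.comp_apply, ContinuousMultilinearMap.linearDeriv_apply, hl,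
    traceCLM_apply, LinearMap.trace_eq_matrix_trace ℝ b, Matrix.trace]
  refine Finset.sum_congr rfl fun i _ ↦ ?_
  change _ = b.det (Function.update b i (B (b i)))
  rw [basis_det_update, Matrix.diag_apply, LinearMap.toMatrix_apply]
  rfl

/-- Jacobi's formula. -/
theorem hasFDerivAt_det (A : E ≃L[ℝ] E) :
    HasFDerivAt (fun B : E →L[ℝ] E ↦ B.det) ((A : E →L[ℝ] E).det •
      (traceCLM E).comp (ContinuousLinearMap.compL ℝ E E E (A.symm : E →L[ℝ] E))) A := by
  have h1 : HasFDerivAt (fun B : E →L[ℝ] E ↦ (A.symm : E →L[ℝ] E).comp B)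
      (ContinuousLinearMap.compL ℝ E E E (A.symm : E →L[ℝ] E)) (A : E →L[ℝ] E) :=
    (ContinuousLinearMap.compL ℝ E E E (A.symm : E →L[ℝ] E)).hasFDerivAt
  have h0 : (A.symm : E →L[ℝ] E).comp (A : E →L[ℝ] E) = 1 := by ext; simp
  have h2 := (HasFDerivAt.comp (g := fun B : E →L[ℝ] E ↦ B.det)
    (A : E →L[ℝ] E) (by rw [h0]; exact hasFDerivAt_det_one) h1).const_mul (A : E →L[ℝ] E).det
  refine h2.congr_of_eventuallyEq (Eventually.of_forall fun B ↦ ?_)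
  -- Writing `det B = det A * det (A⁻¹ B)` reduces the derivative at `A` to the one at the identity.
  have hA : (A : E →L[ℝ] E).comp ((A.symm : E →L[ℝ] E).comp B) = B := by ext; simp
  have : (A : E →L[ℝ] E).det * ((A.symm : E →L[ℝ] E).comp B).det =
      ((A : E →L[ℝ] E).comp ((A.symm : E →L[ℝ] E).comp B)).det :=
    (LinearMap.det_comp (A : E →ₗ[ℝ] E) (((A.symm : E →L[ℝ] E).comp B : E →L[ℝ] E) :
      E →ₗ[ℝ] E)).symm
  rw [hA] at this
  exact this.symm

/-- Change of variables for the divergence of a vector density. -/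
theorem euclDiv_of_fderiv_apply_eq {σ Y Y' : E → E} {y : E} (hσ : ContDiffAt ℝ 2 σ y)
    (A : E ≃L[ℝ] E) (hA : (A : E →L[ℝ] E) = fderiv ℝ σ y)
    (hY : DifferentiableAt ℝ Y (σ y)) (hY' : DifferentiableAt ℝ Y' y)
    (heq : ∀ᶠ z in 𝓝 y, fderiv ℝ σ z (Y' z) = (fderiv ℝ σ z).det • Y (σ z)) :
    euclDiv Y' y = (fderiv ℝ σ y).det * euclDiv Y (σ y) := by
  have hσ1 : HasFDerivAt σ (A : E →L[ℝ] E) y := by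
    rw [hA]; exact (hσ.differentiableAt (by simp)).hasFDerivAt
  have hσ2 : HasFDerivAt (fderiv ℝ σ) (fderiv ℝ (fderiv ℝ σ) y) y :=
    ((hσ.fderiv_right (m := 1) (by norm_num)).differentiableAt (by simp)).hasFDerivAt
  have hsymm : ∀ a b, fderiv ℝ (fderiv ℝ σ) y a b = fderiv ℝ (fderiv ℝ σ) y b a := fun a b ↦
    (hσ.isSymmSndFDerivAt (by simp)) a b
  have hdet := HasFDerivAt.comp (g := fun B : E →L[ℝ] E ↦ B.det) y
    (by rw [← hA]; exact hasFDerivAt_det A) hσ2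
  have hL := hσ2.clm_apply hY'.hasFDerivAt
  have hR := hdet.smul (HasFDerivAt.comp y hY.hasFDerivAt hσ1)
  have key := hL.unique (hR.congr_of_eventuallyEq heq)
  have hpt : A (Y' y) = (fderiv ℝ σ y).det • Y (σ y) := by
    have := heq.self_of_nhds
    rwa [← hA] at this ⊢
  have hpt' : (fderiv ℝ σ y).det • A.symm (Y (σ y)) = Y' y := by
    rw [← map_smul, ← hpt, A.symm_apply_apply]
  have hflip : (fderiv ℝ (fderiv ℝ σ) y).flip (Y' y) = fderiv ℝ (fderiv ℝ σ) y (Y' y) := by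
    ext w; exact hsymm _ _
  have e1 : (A.symm : E →L[ℝ] E).comp ((A : E →L[ℝ] E).comp (fderiv ℝ Y' y)) = fderiv ℝ Y' y := by
    ext; simp
  have e2 : traceCLM E ((A.symm : E →L[ℝ] E).comp ((fderiv ℝ Y (σ y)).comp (A : E →L[ℝ] E))) =
      euclDiv Y (σ y) := by
    rw [traceCLM_comp_comm, euclDiv_eq]
    congr 1
    ext; simp
  have e3 : ∀ (l : E →L[ℝ] ℝ) (w : E), (A.symm : E →L[ℝ] E).comp (l.smulRight w) =
      l.smulRight (A.symm w) := fun l w ↦ by ext; simp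
  -- Apply `A⁻¹` to the differentiated relation and take traces. Jacobi's formula and the derivative
  -- of `Dσ` each give a term in `D²σ`; since `Y' = det A • A⁻¹ Y` at `y`, symmetry of `D²σ` makes
  -- them equal.
  have key2 := congrArg (fun B ↦ traceCLM E ((A.symm : E →L[ℝ] E).comp B)) key
  simp only [Function.comp_apply, ContinuousLinearMap.comp_add, map_add, hflip, ← hA, e1, e3,
    traceCLM_smulRight, ContinuousLinearMap.comp_smul, map_smul, e2] at key2
  simp only [ContinuousLinearMap.comp_apply, smul_apply, ContinuousLinearMap.compL_apply,
    smul_eq_mul] at key2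
  rw [← hA] at hpt'
  rw [← hpt'] at key2
  simp only [map_smul, ContinuousLinearMap.comp_smul, smul_eq_mul, ← euclDiv_eq] at key2
  rw [← hA]
  linarith

end Jacobian

/-! ### Vector fields and volume forms under change of charts. -/

section Charts

variable {n : ℕ} {M : Type*} [TopologicalSpace M] [ChartedSpace (EuclideanSpace ℝ (Fin n)) M]
  {φ ψ : OpenPartialHomeomorph M (EuclideanSpace ℝ (Fin n))}
  {X Z : (x : M) → TangentSpace (𝓡 n) x}

theorem mdifferentiable_of_mem_maximalAtlas (hφ : φ ∈ IsManifold.maximalAtlas (𝓡 n) ∞ M) :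
    φ.MDifferentiable (𝓡 n) (𝓡 n) :=
  ⟨(contMDiffOn_of_mem_maximalAtlas hφ).mdifferentiableOn (by simp),
    (contMDiffOn_symm_of_mem_maximalAtlas hφ).mdifferentiableOn (by simp)⟩

theorem contDiffOn_transition (hφ : φ ∈ IsManifold.maximalAtlas (𝓡 n) ∞ M)
    (hψ : ψ ∈ IsManifold.maximalAtlas (𝓡 n) ∞ M) :
    ContDiffOn ℝ ∞ (φ ∘ ψ.symm) (ψ.target ∩ ψ.symm ⁻¹' φ.source) := by
  rw [← contMDiffOn_iff_contDiffOn]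
  exact (contMDiffOn_of_mem_maximalAtlas hφ).comp'
    (contMDiffOn_symm_of_mem_maximalAtlas hψ)

theorem contDiffAt_transition (hφ : φ ∈ IsManifold.maximalAtlas (𝓡 n) ∞ M)
    (hψ : ψ ∈ IsManifold.maximalAtlas (𝓡 n) ∞ M) {y : EuclideanSpace ℝ (Fin n)}
    (hy : y ∈ ψ.target) (hyφ : ψ.symm y ∈ φ.source) : ContDiffAt ℝ ∞ (φ ∘ ψ.symm) y :=
  (contDiffOn_transition hφ hψ).contDiffAt
    ((ψ.isOpen_inter_preimage_symm φ.open_source).mem_nhds ⟨hy, hyφ⟩)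

theorem fderiv_transition (hφ : φ ∈ IsManifold.maximalAtlas (𝓡 n) ∞ M)
    (hψ : ψ ∈ IsManifold.maximalAtlas (𝓡 n) ∞ M) {y : EuclideanSpace ℝ (Fin n)}
    (hy : y ∈ ψ.target) (hyφ : ψ.symm y ∈ φ.source) :
    fderiv ℝ (φ ∘ ψ.symm) y =
      (mfderiv (𝓡 n) (𝓡 n) φ (ψ.symm y)).comp (mfderiv (𝓡 n) (𝓡 n) ψ.symm y) := by
  rw [← mfderiv_eq_fderiv]
  exact mfderiv_comp y ((mdifferentiable_of_mem_maximalAtlas hφ).mdifferentiableAt hyφ)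
    ((mdifferentiable_of_mem_maximalAtlas hψ).mdifferentiableAt_symm hy)

theorem mfderiv_symm_localRep (hψ : ψ ∈ IsManifold.maximalAtlas (𝓡 n) ∞ M)
    {y : EuclideanSpace ℝ (Fin n)} (hy : y ∈ ψ.target) :
    mfderiv (𝓡 n) (𝓡 n) ψ.symm y (localRep ψ X y) = X (ψ.symm y) := by
  have h := (mdifferentiable_of_mem_maximalAtlas hψ).symm_comp_deriv (ψ.map_target hy)
  rw [ψ.right_inv hy] at h
  exact congrArg (fun A ↦ A (X (ψ.symm y))) h

theorem fderiv_transition_localRep (hφ : φ ∈ IsManifold.maximalAtlas (𝓡 n) ∞ M)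
    (hψ : ψ ∈ IsManifold.maximalAtlas (𝓡 n) ∞ M) {y : EuclideanSpace ℝ (Fin n)}
    (hy : y ∈ ψ.target) (hyφ : ψ.symm y ∈ φ.source) :
    fderiv ℝ (φ ∘ ψ.symm) y (localRep ψ X y) = localRep φ X (φ (ψ.symm y)) := by
  rw [fderiv_transition hφ hψ hy hyφ]
  change mfderiv (𝓡 n) (𝓡 n) φ (ψ.symm y) (mfderiv (𝓡 n) (𝓡 n) ψ.symm y (localRep ψ X y)) = _
  rw [mfderiv_symm_localRep hψ hy, localRep, φ.left_inv hyφ]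

theorem fderiv_transition_comp (hφ : φ ∈ IsManifold.maximalAtlas (𝓡 n) ∞ M)
    (hψ : ψ ∈ IsManifold.maximalAtlas (𝓡 n) ∞ M) {y : EuclideanSpace ℝ (Fin n)}
    (hy : y ∈ ψ.target) (hyφ : ψ.symm y ∈ φ.source) :
    (fderiv ℝ (ψ ∘ φ.symm) (φ (ψ.symm y))).comp (fderiv ℝ (φ ∘ ψ.symm) y) =
      ContinuousLinearMap.id ℝ (EuclideanSpace ℝ (Fin n)) := by
  have hy' : φ (ψ.symm y) ∈ φ.target := φ.map_source hyφ
  have h2 : φ.symm (φ (ψ.symm y)) ∈ ψ.source := by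
    rw [φ.left_inv hyφ]; exact ψ.map_target hy
  have h := fderiv_comp (g := ψ ∘ φ.symm) (f := φ ∘ ψ.symm) y
    ((contDiffAt_transition hψ hφ hy' h2).differentiableAt (by simp))
    ((contDiffAt_transition hφ hψ hy hyφ).differentiableAt (by simp))
  change _ = (fderiv ℝ (ψ ∘ φ.symm) (φ (ψ.symm y))).comp (fderiv ℝ (φ ∘ ψ.symm) y) at h
  rw [← h, ← fderiv_id (𝕜 := ℝ) (x := y)]
  apply Filter.EventuallyEq.fderiv_eq
  filter_upwards [(ψ.isOpen_inter_preimage_symm φ.open_source).mem_nhds ⟨hy, hyφ⟩] with z hz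
  simp [φ.left_inv hz.2, ψ.right_inv hz.1]

/-- The derivative of a change of charts, as a linear equivalence. -/
def transitionEquiv (hφ : φ ∈ IsManifold.maximalAtlas (𝓡 n) ∞ M)
    (hψ : ψ ∈ IsManifold.maximalAtlas (𝓡 n) ∞ M) {y : EuclideanSpace ℝ (Fin n)}
    (hy : y ∈ ψ.target) (hyφ : ψ.symm y ∈ φ.source) :
    EuclideanSpace ℝ (Fin n) ≃L[ℝ] EuclideanSpace ℝ (Fin n) :=
  ContinuousLinearEquiv.equivOfInverse (fderiv ℝ (φ ∘ ψ.symm) y)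
    (fderiv ℝ (ψ ∘ φ.symm) (φ (ψ.symm y)))
    (fun v ↦ congrArg (fun A ↦ A v) (fderiv_transition_comp hφ hψ hy hyφ))
    (fun v ↦ by
      have hy' : φ (ψ.symm y) ∈ φ.target := φ.map_source hyφ
      have h2 : φ.symm (φ (ψ.symm y)) ∈ ψ.source := by
        rw [φ.left_inv hyφ]; exact ψ.map_target hy
      have h := fderiv_transition_comp hψ hφ hy' h2
      rw [φ.left_inv hyφ, ψ.right_inv hy] at h
      exact congrArg (fun A ↦ A v) h)

theorem localRep_eq_transition (hφ : φ ∈ IsManifold.maximalAtlas (𝓡 n) ∞ M)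
    (hψ : ψ ∈ IsManifold.maximalAtlas (𝓡 n) ∞ M) {y : EuclideanSpace ℝ (Fin n)}
    (hy : y ∈ ψ.target) (hyφ : ψ.symm y ∈ φ.source) :
    localRep ψ X y =
      fderiv ℝ (ψ ∘ φ.symm) (φ (ψ.symm y)) (localRep φ X (φ (ψ.symm y))) := by
  rw [← fderiv_transition_localRep hφ hψ hy hyφ]
  exact (congrArg (fun A ↦ A (localRep ψ X y)) (fderiv_transition_comp hφ hψ hy hyφ)).symm

/-- Pulled back by `B`, `f` becomes a top-degree form on `ℝⁿ`, hence a multiple of the determinant.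
-/
theorem alternating_comp_comp {V : Type*} [NormedAddCommGroup V] [NormedSpace ℝ V]
    (f : V [⋀^Fin n]→L[ℝ] ℝ)
    (B : EuclideanSpace ℝ (Fin n) →L[ℝ] V)
    (A : EuclideanSpace ℝ (Fin n) →L[ℝ] EuclideanSpace ℝ (Fin n)) :
    f (fun i ↦ B (A (EuclideanSpace.single i (1 : ℝ)))) =
      A.det * f (fun i ↦ B (EuclideanSpace.single i (1 : ℝ))) := by
  let b := (EuclideanSpace.basisFun (Fin n) ℝ).toBasis
  have hb : ∀ i, b i = EuclideanSpace.single i (1 : ℝ) := fun i ↦ by simp [b]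
  let g : EuclideanSpace ℝ (Fin n) [⋀^Fin n]→ₗ[ℝ] ℝ :=
    f.toAlternatingMap.compLinearMap (B : EuclideanSpace ℝ (Fin n) →ₗ[ℝ] V)
  have h1 := congrArg (fun g' ↦ g' (A ∘ b)) (g.eq_smul_basis_det b)
  have h2 := b.det_comp (A : EuclideanSpace ℝ (Fin n) →ₗ[ℝ] EuclideanSpace ℝ (Fin n)) b
  rw [b.det_self, mul_one] at h2
  have h3 : b.det (A ∘ b) = A.det := h2
  have h4 : g (A ∘ b) = g b * b.det (A ∘ b) := h1
  rw [h3, mul_comm] at h4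
  simpa [g, Function.comp_def, hb] using h4

variable {vol : (x : M) → TangentSpace (𝓡 n) x [⋀^Fin n]→L[ℝ] ℝ}

theorem density_transition (hφ : φ ∈ IsManifold.maximalAtlas (𝓡 n) ∞ M)
    (hψ : ψ ∈ IsManifold.maximalAtlas (𝓡 n) ∞ M) {y : EuclideanSpace ℝ (Fin n)}
    (hy : y ∈ ψ.target) (hyφ : ψ.symm y ∈ φ.source) :
    density vol ψ y = (fderiv ℝ (φ ∘ ψ.symm) y).det * density vol φ (φ (ψ.symm y)) := by
  have h := (mdifferentiable_of_mem_maximalAtlas hφ).symm_comp_deriv hyφ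
  have key : ∀ v, mfderiv (𝓡 n) (𝓡 n) ψ.symm y v =
      mfderiv (𝓡 n) (𝓡 n) φ.symm (φ (ψ.symm y)) (fderiv ℝ (φ ∘ ψ.symm) y v) := fun v ↦ by
    rw [fderiv_transition hφ hψ hy hyφ]
    exact (congrArg (fun A ↦ A (mfderiv (𝓡 n) (𝓡 n) ψ.symm y v)) h).symm
  let vol' : M → EuclideanSpace ℝ (Fin n) [⋀^Fin n]→L[ℝ] ℝ := vol
  let B : EuclideanSpace ℝ (Fin n) →L[ℝ] EuclideanSpace ℝ (Fin n) :=
    mfderiv (𝓡 n) (𝓡 n) φ.symm (φ (ψ.symm y))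
  have h1 : density vol ψ y = vol' (ψ.symm y)
      (fun i ↦ B (fderiv ℝ (φ ∘ ψ.symm) y (EuclideanSpace.single i (1 : ℝ)))) :=
    congrArg (vol' (ψ.symm y)) (funext fun i ↦ key _)
  have h2 : density vol φ (φ (ψ.symm y)) = vol' (φ.symm (φ (ψ.symm y)))
      (fun i ↦ B (EuclideanSpace.single i (1 : ℝ))) := rfl
  rw [h1, h2, φ.left_inv hyφ]
  exact alternating_comp_comp (vol' (ψ.symm y)) B _

/-- The coordinate frame is a basis of the tangent space, and a top-degree form vanishing on a basis
is zero. -/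
theorem density_ne_zero (hvol : ∀ x, vol x ≠ 0) (hφ : φ ∈ IsManifold.maximalAtlas (𝓡 n) ∞ M)
    {y : EuclideanSpace ℝ (Fin n)} (hy : y ∈ φ.target) : density vol φ y ≠ 0 := by
  intro h0
  let B := (mdifferentiable_of_mem_maximalAtlas hφ).symm.mfderiv hy
  let b := (EuclideanSpace.basisFun (Fin n) ℝ).toBasis.map B.toLinearEquiv
  have hb : (fun i ↦ b i) = fun i ↦
      mfderiv (𝓡 n) (𝓡 n) φ.symm y (EuclideanSpace.single i (1 : ℝ)) := by
    funext i
    have e : (EuclideanSpace.basisFun (Fin n) ℝ).toBasis i = EuclideanSpace.single i 1 := by simp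
    exact (Module.Basis.map_apply _ _ _).trans (congrArg B e)
  refine hvol (φ.symm y) ?_
  have := (AlternatingMap.map_basis_eq_zero_iff b (vol (φ.symm y)).toAlternatingMap).1
    (by rw [density, ← hb] at h0; exact h0)
  ext v
  exact congrArg (fun f ↦ f v) this

/-- Presents the local expression as a pull-back by `ψ.symm`, so that regularity of pull-backs of
vector fields applies to it. -/
theorem localRep_eq_mpullback (hψ : ψ ∈ IsManifold.maximalAtlas (𝓡 n) ∞ M)
    {y : EuclideanSpace ℝ (Fin n)} (hy : y ∈ ψ.target) :
    VectorField.mpullback (𝓡 n) (𝓡 n) ψ.symm X y = localRep ψ X y := by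
  let B := (mdifferentiable_of_mem_maximalAtlas hψ).symm.mfderiv hy
  have hB : mfderiv (𝓡 n) (𝓡 n) ψ.symm y = B := rfl
  rw [VectorField.mpullback_apply, hB, ContinuousLinearMap.inverse_equiv]
  rfl

theorem mpullback_localRep (hψ : ψ ∈ IsManifold.maximalAtlas (𝓡 n) ∞ M) {x : M}
    (hx : x ∈ ψ.source) :
    VectorField.mpullback (𝓡 n) (𝓡 n) ψ (localRep ψ X) x = X x := by
  let B := (mdifferentiable_of_mem_maximalAtlas hψ).mfderiv hx
  have hB : mfderiv (𝓡 n) (𝓡 n) ψ x = B := rfl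
  change (mfderiv (𝓡 n) (𝓡 n) ψ x).inverse _ = _
  rw [hB, ContinuousLinearMap.inverse_equiv]
  have : localRep ψ X (ψ x) = B (X x) := by
    rw [localRep, ψ.left_inv hx]; rfl
  rw [this]
  exact B.symm_apply_apply _

variable [IsManifold (𝓡 n) ∞ M]

/-- A vector field is of class `C^s` at a point if and only if its expression in a chart is. -/
theorem contMDiffAt_iff_contDiffAt_localRep {s : ℕ∞}
    (hψ : ψ ∈ IsManifold.maximalAtlas (𝓡 n) ∞ M) {x : M} (hx : x ∈ ψ.source) :
    ContMDiffAt (𝓡 n) (𝓡 n).tangent s (fun x ↦ (⟨x, X x⟩ : TangentBundle (𝓡 n) M)) x ↔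
      ContDiffAt ℝ s (localRep ψ X) (ψ x) := by
  have : IsManifold (𝓡 n) 1 M := IsManifold.of_le (n := ∞) (by simp)
  have hs : (s : ℕ∞ω) + 1 ≤ (∞ : ℕ∞ω) := by exact_mod_cast le_top
  have hy : ψ x ∈ ψ.target := ψ.map_source hx
  constructor
  · intro h
    rw [← ψ.left_inv hx] at h
    have h1 := ContMDiffAt.mpullback_vectorField_preimage (f := ψ.symm) (x₀ := ψ x) h
      (contMDiffAt_symm_of_mem_maximalAtlas hψ hy)
      ⟨(mdifferentiable_of_mem_maximalAtlas hψ).symm.mfderiv hy, rfl⟩ hs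
    refine (contMDiffAt_vectorSpace_iff_contDiffAt.1 h1).congr_of_eventuallyEq ?_
    filter_upwards [ψ.open_target.mem_nhds hy] with z hz
    exact (localRep_eq_mpullback hψ hz).symm
  · intro h
    have h0 : ContMDiffAt (𝓡 n) (𝓡 n).tangent s
        (fun y ↦ (⟨y, localRep ψ X y⟩ : TangentBundle (𝓡 n) (EuclideanSpace ℝ (Fin n)))) (ψ x) :=
      contMDiffAt_vectorSpace_iff_contDiffAt.2 h
    have h1 := ContMDiffAt.mpullback_vectorField_preimage (f := ψ) (x₀ := x) h0
      (contMDiffAt_of_mem_maximalAtlas hψ hx)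
      ⟨(mdifferentiable_of_mem_maximalAtlas hψ).mfderiv hx, rfl⟩ hs
    refine h1.congr_of_eventuallyEq ?_
    filter_upwards [ψ.open_source.mem_nhds hx] with z hz
    rw [mpullback_localRep hψ hz]

theorem contDiffOn_localRep {s : ℕ∞} (hψ : ψ ∈ IsManifold.maximalAtlas (𝓡 n) ∞ M)
    (hX : ContMDiff (𝓡 n) (𝓡 n).tangent s (fun x ↦ (⟨x, X x⟩ : TangentBundle (𝓡 n) M))) :
    ContDiffOn ℝ s (localRep ψ X) ψ.target := by
  intro y hy
  have := (contMDiffAt_iff_contDiffAt_localRep hψ (ψ.map_target hy)).1 (hX (ψ.symm y))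
  rw [ψ.right_inv hy] at this
  exact this.contDiffWithinAt

theorem contMDiff_of_contDiffOn_localRep {s : ℕ∞}
    (h : ∀ ψ ∈ IsManifold.maximalAtlas (𝓡 n) ∞ M, ContDiffOn ℝ s (localRep ψ X) ψ.target) :
    ContMDiff (𝓡 n) (𝓡 n).tangent s (fun x ↦ (⟨x, X x⟩ : TangentBundle (𝓡 n) M)) := by
  intro x
  have hm := IsManifold.chart_mem_maximalAtlas (I := 𝓡 n) (n := ∞) x
  have hx := mem_chart_source (EuclideanSpace ℝ (Fin n)) x
  exact (contMDiffAt_iff_contDiffAt_localRep hm hx).2 ((h _ hm).contDiffAt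
    ((chartAt (EuclideanSpace ℝ (Fin n)) x).open_target.mem_nhds (mem_chart_target _ x)))

end Charts

/-! ### Uniform convergence of derivatives in a one-parameter family. -/

section UniformConvergence

variable {E F : Type*} [NormedAddCommGroup E] [NormedSpace ℝ E] [NormedAddCommGroup F]
  [NormedSpace ℝ F]

theorem iteratedFDeriv_section {G : ℝ × E → F} {O : Set (ℝ × E)} (hO : IsOpen O) {r k : ℕ}
    (hG : ContDiffOn ℝ r G O) (hk : k ≤ r) {t : ℝ} {y : E} (h : (t, y) ∈ O) :
    iteratedFDeriv ℝ k (fun z ↦ G (t, z)) y =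
      (iteratedFDeriv ℝ k G (t, y)).compContinuousLinearMap
        fun _ ↦ ContinuousLinearMap.inr ℝ ℝ E := by
  -- Translating by `(t, 0)` turns the affine slice `z ↦ (t, z)` into the linear inclusion of `E`,
  -- to which the chain rule for iterated derivatives applies.
  set s : Set (ℝ × E) := (fun p ↦ (t, (0 : E)) + p) ⁻¹' O with hs
  have hso : IsOpen s := hO.preimage (by fun_prop)
  have hf : ContDiffOn ℝ r (fun p ↦ G ((t, (0 : E)) + p)) s :=
    hG.comp (by fun_prop) (fun p hp ↦ hp)
  have hx : ContinuousLinearMap.inr ℝ ℝ E y ∈ s := by simpa [hs] using h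
  have hpre : IsOpen (ContinuousLinearMap.inr ℝ ℝ E ⁻¹' s) :=
    hso.preimage (ContinuousLinearMap.inr ℝ ℝ E).continuous
  have key := (ContinuousLinearMap.inr ℝ ℝ E).iteratedFDerivWithin_comp_right hf
    hso.uniqueDiffOn hpre.uniqueDiffOn hx (i := k) (by exact_mod_cast hk)
  rw [iteratedFDerivWithin_of_isOpen k hpre hx, iteratedFDerivWithin_of_isOpen k hso hx,
    iteratedFDeriv_comp_add_left] at key
  simpa [Function.comp_def] using key

/-- If a `C^r` family vanishes at `t = 0`, its `r` first derivatives go to `0` locally uniformly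
as `t → 0`. -/
theorem eventually_norm_iteratedFDeriv_lt {G : ℝ × E → F} {K : Set E} (hK : IsCompact K) {r k : ℕ}
    (hG : ∀ y ∈ K, ContDiffAt ℝ r G (0, y)) (hG0 : ∀ z, G (0, z) = 0) (hk : k ≤ r) {ε : ℝ}
    (hε : 0 < ε) :
    ∀ᶠ t : ℝ in 𝓝 0, ∀ y ∈ K, ‖iteratedFDeriv ℝ k (fun z ↦ G (t, z)) y‖ < ε := by
  apply hK.eventually_forall_of_forall_eventually
  intro y hy
  -- For finite order, being `C^r` at a point is an open condition.
  obtain ⟨O, hOsub, hO, hyO⟩ := _root_.mem_nhds_iff.1 ((hG y hy).eventually (by simp))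
  have hGO : ContDiffOn ℝ r G O := fun p hp ↦
    ContDiffAt.contDiffWithinAt (hOsub hp : ContDiffAt ℝ r G p)
  have hc : ContinuousAt (fun p : ℝ × E ↦ (iteratedFDeriv ℝ k G p).compContinuousLinearMap
      fun _ ↦ ContinuousLinearMap.inr ℝ ℝ E) (0, y) :=
    (ContinuousMultilinearMap.compContinuousLinearMapL
      (fun _ : Fin k ↦ ContinuousLinearMap.inr ℝ ℝ E)).continuous.continuousAt.comp
      ((hG y hy).continuousAt_iteratedFDeriv (by exact_mod_cast hk))
  have h0 : (iteratedFDeriv ℝ k G (0, y)).compContinuousLinearMap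
      (fun _ ↦ ContinuousLinearMap.inr ℝ ℝ E) = 0 := by
    rw [← iteratedFDeriv_section hO hGO hk hyO]
    simp [hG0]
  have hlt := hc.norm.eventually_lt (continuousAt_const (y := ε)) (by rw [h0]; simpa using hε)
  filter_upwards [hlt, hO.mem_nhds hyO] with p hp hpO
  rw [iteratedFDeriv_section hO hGO hk hpO]
  exact hp

end UniformConvergence

/-! ### Divergence on the manifold through vector densities. -/

section Divergence

theorem euclDiv_eq_sum {n : ℕ} (Y : EuclideanSpace ℝ (Fin n) → EuclideanSpace ℝ (Fin n))
    (y : EuclideanSpace ℝ (Fin n)) :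
    euclDiv Y y = ∑ i, fderiv ℝ Y y (EuclideanSpace.single i (1 : ℝ)) i := by
  rw [euclDiv, LinearMap.trace_eq_matrix_trace ℝ (EuclideanSpace.basisFun (Fin n) ℝ).toBasis,
    Matrix.trace]
  refine Finset.sum_congr rfl fun i _ ↦ ?_
  simp [LinearMap.toMatrix_apply]

variable {n : ℕ} {M : Type*} [TopologicalSpace M] [ChartedSpace (EuclideanSpace ℝ (Fin n)) M]
  {φ ψ : OpenPartialHomeomorph M (EuclideanSpace ℝ (Fin n))}
  {X Z : (x : M) → TangentSpace (𝓡 n) x} {vol : VolumeForm n M}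

/-- The expression in the chart `φ` of the vector density `vol ⊗ X`. -/
def densityRep (vol : VolumeForm n M) (φ : OpenPartialHomeomorph M (EuclideanSpace ℝ (Fin n)))
    (X : (x : M) → TangentSpace (𝓡 n) x) (y : EuclideanSpace ℝ (Fin n)) :
    EuclideanSpace ℝ (Fin n) :=
  density vol.toFun φ y • localRep φ X y

theorem contDiffAt_density (hφ : φ ∈ IsManifold.maximalAtlas (𝓡 n) ∞ M)
    {y : EuclideanSpace ℝ (Fin n)} (hy : y ∈ φ.target) :
    ContDiffAt ℝ ∞ (density vol.toFun φ) y :=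
  (vol.smooth φ hφ).contDiffAt (φ.open_target.mem_nhds hy)

theorem contDiffAt_densityRep {s : ℕ∞} (hφ : φ ∈ IsManifold.maximalAtlas (𝓡 n) ∞ M)
    {y : EuclideanSpace ℝ (Fin n)} (hy : y ∈ φ.target) (hX : ContDiffAt ℝ s (localRep φ X) y) :
    ContDiffAt ℝ s (densityRep vol φ X) y :=
  ((contDiffAt_density hφ hy).of_le (by exact_mod_cast le_top)).smul hX

theorem chartDivergence_eq (hφ : φ ∈ IsManifold.maximalAtlas (𝓡 n) ∞ M)
    {y : EuclideanSpace ℝ (Fin n)} (hy : y ∈ φ.target) (hX : ContDiffAt ℝ 1 (localRep φ X) y) :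
    chartDivergence vol X φ y =
      (density vol.toFun φ y)⁻¹ * euclDiv (densityRep vol φ X) y := by
  have hd : DifferentiableAt ℝ (densityRep vol φ X) y :=
    (contDiffAt_densityRep (s := 1) hφ hy hX).differentiableAt (by simp)
  rw [chartDivergence, euclDiv_eq_sum]
  congr 1
  refine Finset.sum_congr rfl fun i _ ↦ ?_
  have h := ((EuclideanSpace.proj (𝕜 := ℝ) i).hasFDerivAt.comp y hd.hasFDerivAt).fderiv
  have h2 := congrArg (fun A ↦ A (EuclideanSpace.single i (1 : ℝ))) h
  exact h2

theorem chartDivergence_eq_zero_iff (hφ : φ ∈ IsManifold.maximalAtlas (𝓡 n) ∞ M)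
    {y : EuclideanSpace ℝ (Fin n)} (hy : y ∈ φ.target) (hX : ContDiffAt ℝ 1 (localRep φ X) y) :
    chartDivergence vol X φ y = 0 ↔ euclDiv (densityRep vol φ X) y = 0 := by
  rw [chartDivergence_eq hφ hy hX, mul_eq_zero, inv_eq_zero]
  simp [density_ne_zero vol.ne_zero hφ hy]

/-- Vanishing of the divergence does not depend on the chart. -/
theorem euclDiv_densityRep_eq_zero (hφ : φ ∈ IsManifold.maximalAtlas (𝓡 n) ∞ M)
    (hψ : ψ ∈ IsManifold.maximalAtlas (𝓡 n) ∞ M) {y : EuclideanSpace ℝ (Fin n)}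
    (hy : y ∈ ψ.target) (hyφ : ψ.symm y ∈ φ.source)
    (hXφ : ContDiffAt ℝ 1 (localRep φ X) (φ (ψ.symm y)))
    (hXψ : ContDiffAt ℝ 1 (localRep ψ X) y)
    (h : euclDiv (densityRep vol φ X) (φ (ψ.symm y)) = 0) :
    euclDiv (densityRep vol ψ X) y = 0 := by
  have hσ := contDiffAt_transition hφ hψ hy hyφ
  have key := euclDiv_of_fderiv_apply_eq (σ := φ ∘ ψ.symm) (Y := densityRep vol φ X)
    (Y' := densityRep vol ψ X) (y := y) (hσ.of_le (WithTop.coe_le_coe.2 le_top))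
    (transitionEquiv hφ hψ hy hyφ) rfl
    ((contDiffAt_densityRep (s := 1) hφ (φ.map_source hyφ) hXφ).differentiableAt (by simp))
    ((contDiffAt_densityRep (s := 1) hψ hy hXψ).differentiableAt (by simp)) ?_
  · rw [key, Function.comp_apply, h, mul_zero]
  · filter_upwards [(ψ.isOpen_inter_preimage_symm φ.open_source).mem_nhds ⟨hy, hyφ⟩] with z hz
    rw [densityRep, map_smul, fderiv_transition_localRep hφ hψ hz.1 hz.2,
      density_transition hφ hψ hz.1 hz.2, mul_smul]
    rfl

end Divergence

/-! ### The averaging operator transported to the manifold. -/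

section SmearedField

theorem isCompact_image_tsupport {M E : Type*} [TopologicalSpace M] [TopologicalSpace E]
    {φ : OpenPartialHomeomorph M E} {χ : E → ℝ} (hc : HasCompactSupport χ) (hsub : tsupport χ ⊆ φ.target) :
    IsCompact (φ.symm '' tsupport χ) :=
  hc.image_of_continuousOn (φ.continuousOn_symm.mono hsub)

theorem image_tsupport_subset_source {M E : Type*} [TopologicalSpace M] [TopologicalSpace E]
    {φ : OpenPartialHomeomorph M E} {χ : E → ℝ} (hsub : tsupport χ ⊆ φ.target) :
    φ.symm '' tsupport χ ⊆ φ.source := by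
  rintro _ ⟨y, hy, rfl⟩
  exact φ.map_target (hsub hy)

variable {n : ℕ} {M : Type*} [TopologicalSpace M] [ChartedSpace (EuclideanSpace ℝ (Fin n)) M]
  {φ ψ : OpenPartialHomeomorph M (EuclideanSpace ℝ (Fin n))}
  {X Z : (x : M) → TangentSpace (𝓡 n) x} {vol : VolumeForm n M}
  {η χ : EuclideanSpace ℝ (Fin n) → ℝ} {t : ℝ}

open Classical in
/-- The vector field on `M` obtained from `X` by averaging in the chart `φ`. -/
def smearedField (vol : VolumeForm n M)
    (φ : OpenPartialHomeomorph M (EuclideanSpace ℝ (Fin n)))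
    (η χ : EuclideanSpace ℝ (Fin n) → ℝ) (X : (x : M) → TangentSpace (𝓡 n) x) (t : ℝ) (x : M) :
    TangentSpace (𝓡 n) x :=
  if x ∈ φ.source then
    (mfderiv (𝓡 n) (𝓡 n) φ x).inverse ((density vol.toFun φ (φ x))⁻¹ •
      smear volume η χ (densityRep vol φ X) t (φ x))
  else X x

theorem localRep_smearedField (hφ : φ ∈ IsManifold.maximalAtlas (𝓡 n) ∞ M)
    {y : EuclideanSpace ℝ (Fin n)} (hy : y ∈ φ.target) :
    localRep φ (smearedField vol φ η χ X t) y =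
      (density vol.toFun φ y)⁻¹ • smear volume η χ (densityRep vol φ X) t y := by
  have hx := φ.map_target hy
  let B := (mdifferentiable_of_mem_maximalAtlas hφ).mfderiv hx
  have hB : mfderiv (𝓡 n) (𝓡 n) φ (φ.symm y) = B := rfl
  rw [localRep, smearedField, if_pos hx, hB, ContinuousLinearMap.inverse_equiv, φ.right_inv hy]
  exact B.apply_symm_apply _

theorem densityRep_smearedField (hφ : φ ∈ IsManifold.maximalAtlas (𝓡 n) ∞ M)
    {y : EuclideanSpace ℝ (Fin n)} (hy : y ∈ φ.target) :
    densityRep vol φ (smearedField vol φ η χ X t) y =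
      smear volume η χ (densityRep vol φ X) t y := by
  rw [densityRep, localRep_smearedField hφ hy,
    smul_inv_smul₀ (density_ne_zero vol.ne_zero hφ hy)]

theorem smearedField_eq_of_smear_eq (hφ : φ ∈ IsManifold.maximalAtlas (𝓡 n) ∞ M) {x : M}
    (h : x ∈ φ.source → smear volume η χ (densityRep vol φ X) t (φ x) = densityRep vol φ X (φ x)) :
    smearedField vol φ η χ X t x = X x := by
  by_cases hx : x ∈ φ.source
  · rw [smearedField, if_pos hx, h hx, densityRep,
      inv_smul_smul₀ (density_ne_zero vol.ne_zero hφ (φ.map_source hx))]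
    exact mpullback_localRep hφ hx
  · rw [smearedField, if_neg hx]

theorem smearedField_of_notMem (hφ : φ ∈ IsManifold.maximalAtlas (𝓡 n) ∞ M)
    (hη1 : ∫ v, η v = 1) {x : M} (hx : x ∉ φ.symm '' tsupport χ) :
    smearedField vol φ η χ X t x = X x := by
  refine smearedField_eq_of_smear_eq hφ fun hxs ↦ smear_of_notMem_tsupport hη1 fun hmem ↦ ?_
  exact hx ⟨φ x, hmem, φ.left_inv hxs⟩

theorem smearedField_zero (hφ : φ ∈ IsManifold.maximalAtlas (𝓡 n) ∞ M) (hη1 : ∫ v, η v = 1) :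
    smearedField vol φ η χ X 0 = X :=
  funext fun _ ↦ smearedField_eq_of_smear_eq hφ fun _ ↦ smear_zero hη1 _

/-- Away from the support of the averaging, a smeared field coincides with the original one. -/
theorem eventually_localRep_smearedField_eq [T2Space M]
    (hφ : φ ∈ IsManifold.maximalAtlas (𝓡 n) ∞ M) (hη1 : ∫ v, η v = 1) (hc : HasCompactSupport χ) (hsub : tsupport χ ⊆ φ.target)
    {y : EuclideanSpace ℝ (Fin n)} (hy : y ∈ ψ.target) (hyC : ψ.symm y ∉ φ.symm '' tsupport χ) :
    ∀ᶠ z in 𝓝 y, ∀ t, localRep ψ (smearedField vol φ η χ X t) z = localRep ψ X z := by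
  have hopen : IsOpen (φ.symm '' tsupport χ)ᶜ :=
    (isCompact_image_tsupport hc hsub).isClosed.isOpen_compl
  filter_upwards [(ψ.isOpen_inter_preimage_symm hopen).mem_nhds ⟨hy, hyC⟩] with z hz t
  rw [localRep, localRep, smearedField_of_notMem hφ hη1 hz.2]

variable [IsManifold (𝓡 n) ∞ M] {r : ℕ∞}

theorem contDiffOn_densityRep (hφ : φ ∈ IsManifold.maximalAtlas (𝓡 n) ∞ M)
    (hX : ContMDiff (𝓡 n) (𝓡 n).tangent r (fun x ↦ (⟨x, X x⟩ : TangentBundle (𝓡 n) M))) :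
    ContDiffOn ℝ r (densityRep vol φ X) φ.target := fun _ hy ↦
  (contDiffAt_densityRep hφ hy ((contDiffOn_localRep hφ hX).contDiffAt
    (φ.open_target.mem_nhds hy))).contDiffWithinAt

theorem contMDiffAt_smearedField_of_smear (hφ : φ ∈ IsManifold.maximalAtlas (𝓡 n) ∞ M) {x : M}
    (hx : x ∈ φ.source)
    (h : ContDiffAt ℝ r (smear volume η χ (densityRep vol φ X) t) (φ x)) :
    ContMDiffAt (𝓡 n) (𝓡 n).tangent r
      (fun x ↦ (⟨x, smearedField vol φ η χ X t x⟩ : TangentBundle (𝓡 n) M)) x := by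
  have hr : (r : ℕ∞ω) ≤ (∞ : ℕ∞ω) := by exact_mod_cast le_top
  have hy := φ.map_source hx
  rw [contMDiffAt_iff_contDiffAt_localRep hφ hx]
  refine ((((contDiffAt_density (vol := vol) hφ hy).of_le hr).inv
    (density_ne_zero vol.ne_zero hφ hy)).smul h).congr_of_eventuallyEq ?_
  filter_upwards [φ.open_target.mem_nhds hy] with z hz using localRep_smearedField hφ hz

variable [T2Space M]

/-- The family of smeared fields is of class `C^r` jointly in the parameter and in the point. -/
theorem contDiffAt_localRep_smearedField (hφ : φ ∈ IsManifold.maximalAtlas (𝓡 n) ∞ M)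
    (hψ : ψ ∈ IsManifold.maximalAtlas (𝓡 n) ∞ M) (hχ : ContDiff ℝ ∞ χ) (hη : ContDiff ℝ ∞ η)
    (hη0 : ∀ v ∉ closedBall (0 : EuclideanSpace ℝ (Fin n)) 1, η v = 0) (hη1 : ∫ v, η v = 1)
    (hc : HasCompactSupport χ) (hsub : tsupport χ ⊆ φ.target)
    (hX : ContMDiff (𝓡 n) (𝓡 n).tangent r (fun x ↦ (⟨x, X x⟩ : TangentBundle (𝓡 n) M)))
    (ht : ∀ y ∈ φ.target, (t, y) ∈ smearDomain χ φ.target)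
    {y : EuclideanSpace ℝ (Fin n)} (hy : y ∈ ψ.target) :
    ContDiffAt ℝ r (fun p : ℝ × EuclideanSpace ℝ (Fin n) ↦
      localRep ψ (smearedField vol φ η χ X p.1) p.2) (t, y) := by
  have hr : (r : ℕ∞ω) ≤ (∞ : ℕ∞ω) := by exact_mod_cast le_top
  by_cases hyφ : ψ.symm y ∈ φ.source
  · have hy' : φ (ψ.symm y) ∈ φ.target := φ.map_source hyφ
    have hyψ : φ.symm (φ (ψ.symm y)) ∈ ψ.source := by
      rw [φ.left_inv hyφ]; exact ψ.map_target hy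
    have hσ : ContDiffAt ℝ r (fun p : ℝ × EuclideanSpace ℝ (Fin n) ↦ φ (ψ.symm p.2)) (t, y) :=
      ContDiffAt.comp (g := φ ∘ ψ.symm) (t, y)
        ((contDiffAt_transition hφ hψ hy hyφ).of_le hr) contDiffAt_snd
    have hD : ContDiffAt ℝ r (fun p : ℝ × EuclideanSpace ℝ (Fin n) ↦
        fderiv ℝ (ψ ∘ φ.symm) (φ (ψ.symm p.2))) (t, y) :=
      ContDiffAt.comp (g := fderiv ℝ (ψ ∘ φ.symm)) (t, y)
        ((contDiffAt_transition hψ hφ hy' hyψ).fderiv_right (by exact_mod_cast le_top)) hσ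
    have hρ : ContDiffAt ℝ r (fun p : ℝ × EuclideanSpace ℝ (Fin n) ↦
        density vol.toFun φ (φ (ψ.symm p.2))) (t, y) :=
      ContDiffAt.comp (g := density vol.toFun φ) (t, y) ((contDiffAt_density hφ hy').of_le hr) hσ
    have hs : ContDiffAt ℝ r (fun p : ℝ × EuclideanSpace ℝ (Fin n) ↦
        smear volume η χ (densityRep vol φ X) p.1 (φ (ψ.symm p.2))) (t, y) :=
      ContDiffAt.comp (g := fun p : ℝ × EuclideanSpace ℝ (Fin n) ↦
          smear volume η χ (densityRep vol φ X) p.1 p.2)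
        (f := fun p : ℝ × EuclideanSpace ℝ (Fin n) ↦ (p.1, φ (ψ.symm p.2))) (t, y)
        ((contDiffOn_smear hχ hη hη0 φ.open_target (contDiffOn_densityRep hφ hX)).contDiffAt
          ((isOpen_smearDomain hχ.continuous φ.open_target).mem_nhds (ht _ hy')))
        (contDiffAt_fst.prodMk hσ)
    refine (hD.clm_apply ((hρ.inv (density_ne_zero vol.ne_zero hφ hy')).smul
      hs)).congr_of_eventuallyEq ?_
    have hopen : IsOpen (Prod.snd ⁻¹' (ψ.target ∩ ψ.symm ⁻¹' φ.source) :
        Set (ℝ × EuclideanSpace ℝ (Fin n))) :=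
      (ψ.isOpen_inter_preimage_symm φ.open_source).preimage continuous_snd
    filter_upwards [hopen.mem_nhds ⟨hy, hyφ⟩] with p hp
    rw [localRep_eq_transition hφ hψ hp.1 hp.2,
      localRep_smearedField hφ (φ.map_source hp.2)]
    rfl
  -- Outside the domain of `φ` the point avoids the compact image of `tsupport χ`, so on one
  -- neighbourhood the field equals `X` for all parameters at once.
  · have h1 : ContDiffAt ℝ r (fun p : ℝ × EuclideanSpace ℝ (Fin n) ↦ localRep ψ X p.2) (t, y) :=
      ContDiffAt.comp (g := localRep ψ X) (t, y)
        ((contDiffOn_localRep hψ hX).contDiffAt (ψ.open_target.mem_nhds hy)) contDiffAt_snd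
    refine h1.congr_of_eventuallyEq ?_
    have h2 := eventually_localRep_smearedField_eq (vol := vol) (X := X) hφ hη1 hc hsub hy
      (fun h ↦ hyφ (image_tsupport_subset_source hsub h))
    filter_upwards [continuousAt_snd.eventually h2] with p hp using hp p.1

theorem contMDiff_smearedField (hφ : φ ∈ IsManifold.maximalAtlas (𝓡 n) ∞ M)
    (hχ : ContDiff ℝ ∞ χ) (hη : ContDiff ℝ ∞ η)
    (hη0 : ∀ v ∉ closedBall (0 : EuclideanSpace ℝ (Fin n)) 1, η v = 0) (hη1 : ∫ v, η v = 1)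
    (hc : HasCompactSupport χ) (hsub : tsupport χ ⊆ φ.target)
    (hX : ContMDiff (𝓡 n) (𝓡 n).tangent r (fun x ↦ (⟨x, X x⟩ : TangentBundle (𝓡 n) M)))
    (ht : ∀ y ∈ φ.target, (t, y) ∈ smearDomain χ φ.target) :
    ContMDiff (𝓡 n) (𝓡 n).tangent r
      (fun x ↦ (⟨x, smearedField vol φ η χ X t x⟩ : TangentBundle (𝓡 n) M)) := by
  refine contMDiff_of_contDiffOn_localRep fun ψ hψ y hy ↦ ?_
  have h := contDiffAt_localRep_smearedField (vol := vol) hφ hψ hχ hη hη0 hη1 hc hsub hX ht hy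
  exact (ContDiffAt.comp (f := fun z : EuclideanSpace ℝ (Fin n) ↦ (t, z)) y h
    (by fun_prop)).contDiffWithinAt

/-- In `φ` the vector density of the new field is the average of closed forms; chart independence
carries this to `ψ`, and outside `φ.source` the field is locally `X`. -/
theorem isDivFree_smearedField (hφ : φ ∈ IsManifold.maximalAtlas (𝓡 n) ∞ M)
    (hχ : ContDiff ℝ ∞ χ) (hη : ContDiff ℝ ∞ η)
    (hη0 : ∀ v ∉ closedBall (0 : EuclideanSpace ℝ (Fin n)) 1, η v = 0) (hη1 : ∫ v, η v = 1)
    (hc : HasCompactSupport χ) (hsub : tsupport χ ⊆ φ.target)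
    (hX : ContMDiff (𝓡 n) (𝓡 n).tangent 1 (fun x ↦ (⟨x, X x⟩ : TangentBundle (𝓡 n) M)))
    (hdiv : IsDivFree vol X) (ht : ∀ y ∈ φ.target, (t, y) ∈ smearDomain χ φ.target) :
    IsDivFree vol (smearedField vol φ η χ X t) := by
  have hZ := contMDiff_smearedField (r := 1) (vol := vol) hφ hχ hη hη0 hη1 hc hsub hX ht
  have hat : ∀ {W : (x : M) → TangentSpace (𝓡 n) x},
      ContMDiff (𝓡 n) (𝓡 n).tangent 1 (fun x ↦ (⟨x, W x⟩ : TangentBundle (𝓡 n) M)) →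
      ∀ ψ ∈ IsManifold.maximalAtlas (𝓡 n) ∞ M, ∀ y ∈ ψ.target,
      ContDiffAt ℝ 1 (localRep ψ W) y := fun hW ψ hψ y hy ↦
    (contDiffOn_localRep (s := 1) hψ hW).contDiffAt (ψ.open_target.mem_nhds hy)
  have hXdiv : ∀ ψ ∈ IsManifold.maximalAtlas (𝓡 n) ∞ M, ∀ y ∈ ψ.target,
      euclDiv (densityRep vol ψ X) y = 0 := fun ψ hψ y hy ↦
    (chartDivergence_eq_zero_iff hψ hy (hat hX ψ hψ y hy)).1 (hdiv ψ hψ y hy)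
  intro ψ hψ y hy
  rw [chartDivergence_eq_zero_iff hψ hy (hat hZ ψ hψ y hy)]
  by_cases hyφ : ψ.symm y ∈ φ.source
  · have hy' : φ (ψ.symm y) ∈ φ.target := φ.map_source hyφ
    refine euclDiv_densityRep_eq_zero hφ hψ hy hyφ (hat hZ φ hφ _ hy') (hat hZ ψ hψ y hy) ?_
    have heq : densityRep vol φ (smearedField vol φ η χ X t) =ᶠ[𝓝 (φ (ψ.symm y))]
        smear volume η χ (densityRep vol φ X) t := by
      filter_upwards [φ.open_target.mem_nhds hy'] with z hz using densityRep_smearedField hφ hz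
    rw [euclDiv, heq.fderiv_eq]
    exact euclDiv_smear hχ hη hη0 φ.open_target (contDiffOn_densityRep (r := 1) hφ hX)
      (hXdiv φ hφ) (ht _ hy')
  · have heq : densityRep vol ψ (smearedField vol φ η χ X t) =ᶠ[𝓝 y] densityRep vol ψ X := by
      filter_upwards [eventually_localRep_smearedField_eq (vol := vol) (X := X) hφ hη1 hc hsub hy
        (fun h ↦ hyφ (image_tsupport_subset_source hsub h))] with z hz
      rw [densityRep, densityRep, hz]
    rw [euclDiv, heq.fderiv_eq]
    exact hXdiv ψ hψ y hy

/-- For small `t ≠ 0`, the smeared field is smooth on a compact set `K` near which the original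
field is smooth, and on the set where the averaging is effective. -/
theorem eventually_contMDiffAt_smearedField (hφ : φ ∈ IsManifold.maximalAtlas (𝓡 n) ∞ M)
    (hχ : ContDiff ℝ ∞ χ) (hη : ContDiff ℝ ∞ η)
    (hη0 : ∀ v ∉ closedBall (0 : EuclideanSpace ℝ (Fin n)) 1, η v = 0) (hη1 : ∫ v, η v = 1)
    (hc : HasCompactSupport χ) (hsub : tsupport χ ⊆ φ.target)
    (hX : ContMDiff (𝓡 n) (𝓡 n).tangent r (fun x ↦ (⟨x, X x⟩ : TangentBundle (𝓡 n) M)))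
    {U K L : Set M} (hU : IsOpen U) (hK : IsCompact K) (hKU : K ⊆ U)
    (hXU : ∀ x ∈ U, ContMDiffAt (𝓡 n) (𝓡 n).tangent ∞
      (fun x ↦ (⟨x, X x⟩ : TangentBundle (𝓡 n) M)) x)
    (hL : L ⊆ φ.source) (hLχ : ∀ x ∈ L, χ (φ x) ≠ 0) :
    ∀ᶠ t in 𝓝[≠] (0 : ℝ), ∀ x ∈ K ∪ L, ContMDiffAt (𝓡 n) (𝓡 n).tangent ∞
      (fun x ↦ (⟨x, smearedField vol φ η χ X t x⟩ : TangentBundle (𝓡 n) M)) x := by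
  set C := φ.symm '' tsupport χ with hC
  have hCc : IsCompact C := isCompact_image_tsupport hc hsub
  have hCs : C ⊆ φ.source := image_tsupport_subset_source hsub
  set O := φ.target ∩ φ.symm ⁻¹' U with hOdef
  have hO : IsOpen O := φ.isOpen_inter_preimage_symm hU
  have hYO : ContDiffOn ℝ ∞ (densityRep vol φ X) O := fun y hy ↦ by
    have h := (contMDiffAt_iff_contDiffAt_localRep (s := ⊤) hφ (φ.map_target hy.1)).1
      (hXU _ hy.2)
    rw [φ.right_inv hy.1] at h
    exact (contDiffAt_densityRep (s := ⊤) hφ hy.1 h).contDiffWithinAt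
  have hK' : IsCompact (φ '' (C ∩ K)) :=
    (hCc.inter_right hK.isClosed).image_of_continuousOn
      (φ.continuousOn.mono (inter_subset_left.trans hCs))
  have hK'O : φ '' (C ∩ K) ⊆ O := by
    rintro _ ⟨x, ⟨hxC, hxK⟩, rfl⟩
    refine ⟨φ.map_source (hCs hxC), ?_⟩
    rw [mem_preimage, φ.left_inv (hCs hxC)]
    exact hKU hxK
  -- `O` is the part of the chart where `X` is already smooth. For small `t`, averaging at points of
  -- the compact set `φ '' (C ∩ K)` samples only `O`, so it preserves smoothness there.
  have e1 := (eventually_mem_smearDomain hχ.continuous hO hK' hK'O).filter_mono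
    (nhdsWithin_le_nhds (s := {(0 : ℝ)}ᶜ))
  have e2 := (eventually_forall_mem_smearDomain hχ.continuous φ.open_target hc hsub).filter_mono
    (nhdsWithin_le_nhds (s := {(0 : ℝ)}ᶜ))
  filter_upwards [e1, e2, self_mem_nhdsWithin] with t h1 h2 ht0 x hx
  rcases hx with hxK | hxL
  · by_cases hxC : x ∈ C
    · refine contMDiffAt_smearedField_of_smear (r := ⊤) hφ (hCs hxC) ?_
      have hty : (t, φ x) ∈ smearDomain χ O := h1 _ ⟨x, ⟨hxC, hxK⟩, rfl⟩
      have h := (contDiffOn_smear (n := ⊤) (μ := volume) hχ hη hη0 hO hYO).contDiffAt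
        ((isOpen_smearDomain hχ.continuous hO).mem_nhds hty)
      exact ContDiffAt.comp (f := fun z : EuclideanSpace ℝ (Fin n) ↦ (t, z)) (φ x) h
        (by fun_prop)
    · refine (hXU x (hKU hxK)).congr_of_eventuallyEq ?_
      filter_upwards [hCc.isClosed.isOpen_compl.mem_nhds hxC] with z hz
      rw [smearedField_of_notMem hφ hη1 hz]
  -- Only here is `t ≠ 0` needed: on `L` smoothness comes from convolution with positive radius.
  · refine contMDiffAt_smearedField_of_smear (r := ⊤) hφ (hL hxL) ?_
    exact contDiffAt_smear_of_ne_zero hχ hη hη0 φ.open_target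
      (contDiffOn_densityRep hφ hX).continuousOn (h2 _ (φ.map_source (hL hxL))) ht0
      (hLχ x hxL)

end SmearedField

/-! ### Approximation in the Whitney norm and induction over the atlas. -/

section Density

variable {n : ℕ} {M : Type*} [TopologicalSpace M] [ChartedSpace (EuclideanSpace ℝ (Fin n)) M]

theorem localRep_sub (ψ : OpenPartialHomeomorph M (EuclideanSpace ℝ (Fin n)))
    (X Z : (x : M) → TangentSpace (𝓡 n) x) (y : EuclideanSpace ℝ (Fin n)) :
    localRep ψ (Z - X) y = localRep ψ Z y - localRep ψ X y :=
  map_sub (mfderiv (𝓡 n) (𝓡 n) ψ (ψ.symm y)) (Z (ψ.symm y)) (X (ψ.symm y))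

theorem exists_smooth_kernel (n : ℕ) : ∃ η : EuclideanSpace ℝ (Fin n) → ℝ, ContDiff ℝ ∞ η ∧
    (∀ v ∉ closedBall (0 : EuclideanSpace ℝ (Fin n)) 1, η v = 0) ∧ ∫ v, η v = 1 := by
  let f : ContDiffBump (0 : EuclideanSpace ℝ (Fin n)) := ⟨1 / 2, 1, by norm_num, by norm_num⟩
  refine ⟨f.normed volume, f.contDiff_normed, fun v hv ↦ ?_, f.integral_normed⟩
  have : v ∉ Function.support (f.normed volume) := by
    rw [f.support_normed_eq]
    exact fun h ↦ hv (ball_subset_closedBall h)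
  simpa using this

/-- Nonvanishing on `K` suffices, since `χ` scales the convolution radius and is never used as a
partition function. -/
theorem exists_smooth_cutoff {E : Type*} [NormedAddCommGroup E] [NormedSpace ℝ E]
    [FiniteDimensional ℝ E] {K O : Set E} (hK : IsCompact K) (hO : IsOpen O) (hKO : K ⊆ O) :
    ∃ χ : E → ℝ, ContDiff ℝ ∞ χ ∧ HasCompactSupport χ ∧ tsupport χ ⊆ O ∧ ∀ y ∈ K, χ y ≠ 0 := by
  have : ProperSpace E := FiniteDimensional.proper ℝ E
  obtain ⟨K', hK', hKK', hK'O⟩ := exists_compact_between hK hO hKO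
  obtain ⟨χ, hsupp, hχ, -⟩ := (isOpen_interior (s := K')).exists_contDiff_support_eq (n := ⊤)
  have hts : tsupport χ ⊆ K' := by
    rw [tsupport, hsupp]
    exact closure_minimal interior_subset hK'.isClosed
  refine ⟨χ, hχ, hK'.of_isClosed_subset (isClosed_tsupport χ) hts, hts.trans hK'O, ?_⟩
  intro y hy
  have : y ∈ Function.support χ := by rw [hsupp]; exact hKK' hy
  exact this

variable [IsManifold (𝓡 n) ∞ M] {r : ℕ}
  {X Z : (x : M) → TangentSpace (𝓡 n) x} {vol : VolumeForm n M} {A : RegularAtlas n M}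

theorem whitneyNorm_sub_le {W : (x : M) → TangentSpace (𝓡 n) x}
    (hX : ContMDiff (𝓡 n) (𝓡 n).tangent r (fun x ↦ (⟨x, X x⟩ : TangentBundle (𝓡 n) M)))
    (hZ : ContMDiff (𝓡 n) (𝓡 n).tangent r (fun x ↦ (⟨x, Z x⟩ : TangentBundle (𝓡 n) M)))
    (hW : ContMDiff (𝓡 n) (𝓡 n).tangent r (fun x ↦ (⟨x, W x⟩ : TangentBundle (𝓡 n) M))) :
    whitneyNorm A r (W - X) ≤ whitneyNorm A r (W - Z) + whitneyNorm A r (Z - X) := by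
  refine iSup_le fun j ↦ iSup₂_le fun k hk ↦ iSup₂_le fun y hy ↦ ?_
  have hyt : y ∈ (A.Φ j).target := by
    obtain ⟨x, hx, rfl⟩ := hy
    exact (A.Φ j).map_source (A.closure_subset j (subset_closure hx))
  have hat : ∀ {V : (x : M) → TangentSpace (𝓡 n) x},
      ContMDiff (𝓡 n) (𝓡 n).tangent r (fun x ↦ (⟨x, V x⟩ : TangentBundle (𝓡 n) M)) →
      ContDiffAt ℝ k (localRep (A.Φ j) V) y := fun hV ↦
    ((contDiffOn_localRep (s := r) (A.chart_mem j) hV).contDiffAt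
      ((A.Φ j).open_target.mem_nhds hyt)).of_le (by exact_mod_cast hk)
  have hsplit : localRep (A.Φ j) (W - X) =
      localRep (A.Φ j) (W - Z) + localRep (A.Φ j) (Z - X) := by
    ext1 z
    simp [localRep_sub]
  have hsub : ∀ {V V' : (x : M) → TangentSpace (𝓡 n) x}, ContDiffAt ℝ k (localRep (A.Φ j) V) y →
      ContDiffAt ℝ k (localRep (A.Φ j) V') y → ContDiffAt ℝ k (localRep (A.Φ j) (V - V')) y :=
    fun h h' ↦ (h.sub h').congr_of_eventuallyEq (Eventually.of_forall (localRep_sub _ _ _))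
  have hadd : iteratedFDeriv ℝ k (localRep (A.Φ j) (W - X)) y =
      iteratedFDeriv ℝ k (localRep (A.Φ j) (W - Z)) y +
        iteratedFDeriv ℝ k (localRep (A.Φ j) (Z - X)) y := by
    rw [hsplit]
    exact iteratedFDeriv_add_apply (hsub (hat hW) (hat hZ)) (hsub (hat hZ) (hat hX))
  have hle : ∀ V : (x : M) → TangentSpace (𝓡 n) x,
      ‖iteratedFDeriv ℝ k (localRep (A.Φ j) V) y‖ₑ ≤ whitneyNorm A r V := fun V ↦
    le_iSup_of_le j (le_iSup₂_of_le k hk (le_iSup₂_of_le y hy le_rfl))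
  rw [hadd]
  exact (enorm_add_le _ _).trans (add_le_add (hle _) (hle _))

variable [T2Space M] [CompactSpace M]

/-- Finitely many charts and orders occur, and each chart contributes a compact set `closure (A.V
j)`; on each, joint `C^r` regularity in `(t, y)` and equality with `X` at `t = 0` give uniform
convergence. -/
theorem eventually_whitneyNorm_smearedField_lt
    {φ : OpenPartialHomeomorph M (EuclideanSpace ℝ (Fin n))}
    {η χ : EuclideanSpace ℝ (Fin n) → ℝ} (hφ : φ ∈ IsManifold.maximalAtlas (𝓡 n) ∞ M)
    (hχ : ContDiff ℝ ∞ χ) (hη : ContDiff ℝ ∞ η)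
    (hη0 : ∀ v ∉ closedBall (0 : EuclideanSpace ℝ (Fin n)) 1, η v = 0) (hη1 : ∫ v, η v = 1)
    (hc : HasCompactSupport χ) (hsub : tsupport χ ⊆ φ.target)
    (hX : ContMDiff (𝓡 n) (𝓡 n).tangent r (fun x ↦ (⟨x, X x⟩ : TangentBundle (𝓡 n) M)))
    {ε : ℝ} (hε : 0 < ε) :
    ∀ᶠ t in 𝓝 (0 : ℝ),
      whitneyNorm A r (smearedField vol φ η χ X t - X) < ENNReal.ofReal ε := by
  have hdom := eventually_forall_mem_smearDomain hχ.continuous φ.open_target hc hsub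
  have key : ∀ j : Fin A.m, ∀ k ∈ Finset.range (r + 1), ∀ᶠ t in 𝓝 (0 : ℝ),
      ∀ y ∈ A.Φ j '' closure (A.V j), ‖iteratedFDeriv ℝ k
        (localRep (A.Φ j) (smearedField vol φ η χ X t - X)) y‖ < ε / 2 := by
    intro j k hk
    have hsource : closure (A.V j) ⊆ (A.Φ j).source := A.closure_subset j
    have hK : IsCompact (A.Φ j '' closure (A.V j)) :=
      isClosed_closure.isCompact.image_of_continuousOn ((A.Φ j).continuousOn.mono hsource)
    let G : ℝ × EuclideanSpace ℝ (Fin n) → EuclideanSpace ℝ (Fin n) := fun p ↦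
      localRep (A.Φ j) (smearedField vol φ η χ X p.1) p.2 - localRep (A.Φ j) X p.2
    have hG : ∀ y ∈ A.Φ j '' closure (A.V j), ContDiffAt ℝ r G (0, y) := by
      rintro _ ⟨x, hx, rfl⟩
      have hy := (A.Φ j).map_source (hsource hx)
      have h1 := contDiffAt_localRep_smearedField (r := r) (vol := vol) hφ (A.chart_mem j) hχ hη
        hη0 hη1 hc hsub hX hdom.self_of_nhds hy
      have h2 : ContDiffAt ℝ r (fun p : ℝ × EuclideanSpace ℝ (Fin n) ↦
          localRep (A.Φ j) X p.2) (0, A.Φ j x) :=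
        ContDiffAt.comp (g := localRep (A.Φ j) X) (0, A.Φ j x)
          ((contDiffOn_localRep (s := r) (A.chart_mem j) hX).contDiffAt
            ((A.Φ j).open_target.mem_nhds hy)) contDiffAt_snd
      exact h1.sub h2
    have hG0 : ∀ z, G (0, z) = 0 := fun z ↦ by
      simp only [G, smearedField_zero hφ hη1, sub_self]
    filter_upwards [eventually_norm_iteratedFDeriv_lt hK hG hG0
      (Nat.lt_succ_iff.1 (Finset.mem_range.1 hk)) (half_pos hε)] with t ht y hy
    have : localRep (A.Φ j) (smearedField vol φ η χ X t - X) = fun z ↦ G (t, z) :=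
      funext fun z ↦ localRep_sub _ _ _ z
    rw [this]
    exact ht y hy
  have hall := eventually_all.2 fun j ↦ (Finset.eventually_all (Finset.range (r + 1))).2 (key j)
  filter_upwards [hall] with t ht
  -- The bound `ε / 2` keeps the inequality strict after passing to the supremum.
  refine lt_of_le_of_lt (b := ENNReal.ofReal (ε / 2)) ?_
    ((ENNReal.ofReal_lt_ofReal_iff hε).2 (half_lt_self hε))
  refine iSup_le fun j ↦ iSup₂_le fun k hk ↦ iSup₂_le fun y hy ↦ ?_
  rw [← ofReal_norm]
  exact ENNReal.ofReal_le_ofReal (ht j k (Finset.mem_range.2 (Nat.lt_succ_of_le hk)) y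
    (image_mono subset_closure hy)).le

/-- A divergence-free field can be smoothed out near a compact subset of a chart domain, by a
`C^r`-small perturbation which is divergence-free and preserves smoothness near a compact set. -/
theorem exists_divFree_smooth_near (hr : 1 ≤ r) (hX : X ∈ divFreeFields vol r)
    {φ : OpenPartialHomeomorph M (EuclideanSpace ℝ (Fin n))}
    (hφ : φ ∈ IsManifold.maximalAtlas (𝓡 n) ∞ M) {U K L : Set M} (hU : IsOpen U)
    (hK : IsCompact K) (hKU : K ⊆ U)
    (hXU : ∀ x ∈ U, ContMDiffAt (𝓡 n) (𝓡 n).tangent ∞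
      (fun x ↦ (⟨x, X x⟩ : TangentBundle (𝓡 n) M)) x)
    (hL : IsCompact L) (hLφ : L ⊆ φ.source) {ε : ℝ} (hε : 0 < ε) :
    ∃ Z ∈ divFreeFields vol r, whitneyNorm A r (Z - X) < ENNReal.ofReal ε ∧
      ∃ U' : Set M, IsOpen U' ∧ K ∪ L ⊆ U' ∧ ∀ x ∈ U', ContMDiffAt (𝓡 n) (𝓡 n).tangent ∞
        (fun x ↦ (⟨x, Z x⟩ : TangentBundle (𝓡 n) M)) x := by
  -- Smoothing on compact thickenings of `K` and `L` yields smoothness on the open union of their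
  -- interiors, as required to iterate.
  obtain ⟨K₁, hK₁, hKK₁, hK₁U⟩ := exists_compact_between hK hU hKU
  obtain ⟨L₁, hL₁, hLL₁, hL₁φ⟩ := exists_compact_between hL φ.open_source hLφ
  obtain ⟨η, hη, hη0, hη1⟩ := exists_smooth_kernel n
  obtain ⟨χ, hχ, hc, hsub, hχL⟩ := exists_smooth_cutoff
    (hL₁.image_of_continuousOn (φ.continuousOn.mono hL₁φ)) φ.open_target
    (image_subset_iff.2 fun x hx ↦ φ.map_source (hL₁φ hx))
  have hX1 : ContMDiff (𝓡 n) (𝓡 n).tangent 1 (fun x ↦ (⟨x, X x⟩ : TangentBundle (𝓡 n) M)) :=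
    hX.1.of_le (by exact_mod_cast hr)
  have e1 := eventually_contMDiffAt_smearedField (vol := vol) hφ hχ hη hη0 hη1 hc hsub hX.1 hU hK₁
    hK₁U hXU hL₁φ (fun x hx ↦ hχL _ (mem_image_of_mem φ hx))
  have e2 := (eventually_forall_mem_smearDomain hχ.continuous φ.open_target hc hsub).filter_mono
    (nhdsWithin_le_nhds (s := {(0 : ℝ)}ᶜ))
  have e3 := (eventually_whitneyNorm_smearedField_lt (A := A) (vol := vol) hφ hχ hη hη0 hη1 hc hsub
    hX.1 hε).filter_mono (nhdsWithin_le_nhds (s := {(0 : ℝ)}ᶜ))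
  obtain ⟨t, h1, h2, h3⟩ := (e1.and (e2.and e3)).exists
  refine ⟨smearedField vol φ η χ X t,
    ⟨contMDiff_smearedField hφ hχ hη hη0 hη1 hc hsub hX.1 h2,
      isDivFree_smearedField hφ hχ hη hη0 hη1 hc hsub hX1 hX.2 h2⟩, h3,
    interior K₁ ∪ interior L₁, isOpen_interior.union isOpen_interior,
    union_subset_union hKK₁ hLL₁, fun x hx ↦ h1 x ?_⟩
  exact union_subset_union interior_subset interior_subset hx

/-- Each new chart is smoothed at cost `ε / 2` on top of the `ε / 2` spent before. Carrying an open
neighbourhood of the closures already treated lets the next averaging preserve smoothness there. -/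
theorem exists_divFree_smooth_near_union (hr : 1 ≤ r) (hX : X ∈ divFreeFields vol r)
    (s : Finset (Fin A.m)) : ∀ ε : ℝ, 0 < ε →
    ∃ Z ∈ divFreeFields vol r, whitneyNorm A r (Z - X) < ENNReal.ofReal ε ∧
      ∃ U : Set M, IsOpen U ∧ (⋃ j ∈ s, closure (A.V j)) ⊆ U ∧
        ∀ x ∈ U, ContMDiffAt (𝓡 n) (𝓡 n).tangent ∞
          (fun x ↦ (⟨x, Z x⟩ : TangentBundle (𝓡 n) M)) x := by
  induction s using Finset.induction_on with
  | empty =>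
    intro ε hε
    refine ⟨X, hX, ?_, ∅, isOpen_empty, by simp, by simp⟩
    have h0 : ∀ j, localRep (A.Φ j) (X - X) = 0 := fun j ↦ funext fun z ↦ by
      rw [localRep_sub, sub_self]; rfl
    have : whitneyNorm A r (X - X) = 0 := by
      simp only [whitneyNorm, h0]
      simp
    rw [this]
    simpa using hε
  | insert j s _ ih =>
    intro ε hε
    obtain ⟨Z, hZ, hZX, U, hU, hsU, hZU⟩ := ih (ε / 2) (half_pos hε)
    obtain ⟨W, hW, hWZ, U', hU', hsU', hWU'⟩ := exists_divFree_smooth_near (A := A) hr hZ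
      (A.chart_mem j) hU (s.isCompact_biUnion fun i _ ↦ isClosed_closure.isCompact) hsU hZU
      (L := closure (A.V j)) isClosed_closure.isCompact (A.closure_subset j) (half_pos hε)
    refine ⟨W, hW, ?_, U', hU', ?_, hWU'⟩
    · calc whitneyNorm A r (W - X)
          ≤ whitneyNorm A r (W - Z) + whitneyNorm A r (Z - X) := whitneyNorm_sub_le hX.1 hZ.1 hW.1
        _ < ENNReal.ofReal (ε / 2) + ENNReal.ofReal (ε / 2) := ENNReal.add_lt_add hWZ hZX
        _ = ENNReal.ofReal ε := by
          rw [← ENNReal.ofReal_add (half_pos hε).le (half_pos hε).le, add_halves]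
    · rw [Finset.set_biUnion_insert, union_comm]
      exact hsU'

end Density

end DivFreeDensity

end

theorem theorem4 {n : ℕ} (hn : 2 ≤ n) {M : Type*} [TopologicalSpace M] [T2Space M]
    [CompactSpace M] [ConnectedSpace M] [ChartedSpace (EuclideanSpace ℝ (Fin n)) M]
    [IsManifold (𝓡 n) ∞ M] (vol : DivFreeDensity.VolumeForm n M)
    (A : DivFreeDensity.RegularAtlas n M) (r : ℕ) (hr : 1 ≤ r) :
    DivFreeDensity.IsCrDenseIn A r
      (DivFreeDensity.divFreeFields vol ⊤) (DivFreeDensity.divFreeFields vol r) := by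
  refine ⟨fun X hX ↦ ⟨hX.1.of_le (by exact_mod_cast le_top), hX.2⟩, fun X hX ε hε ↦ ?_⟩
  obtain ⟨Z, hZ, hZX, U, -, hsU, hZU⟩ :=
    DivFreeDensity.exists_divFree_smooth_near_union (A := A) hr hX Finset.univ ε hε
  refine ⟨Z, ⟨fun x ↦ hZU x (hsU ?_), hZ.2⟩, hZX⟩
  have hx : x ∈ ⋃ j, A.V j := by rw [A.cover]; trivial
  obtain ⟨j, hj⟩ := Set.mem_iUnion.1 hx
  exact Set.mem_biUnion (Finset.mem_univ j) (subset_closure hj)
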